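/- Let $K$ be a field of characteristic $0$ (for example a $p$-adic field) with algebraic closure $\overline K$ and absolute Galois group $G_K$, and let $E/K$ be an elliptic curve with Weil pairing $e_3$ on $E[3]$. Let $\Lambda$ be the set of lines in the affine plane $E[3]\cong\mathbb F_3^2$ that do not pass through $0$, and let $L^+$, $L$, $L'$, $M$, $R$ be the étale $K$-algebras $\operatorname{Map}_K(X,\overline K)$ of Galois equivariant maps on the sets $X=\mathbb P(E[3])$ (the lines through $0$), $E[3]\setminus\{0\}$, $\Lambda$, $\{(T,\lambda)\in (E[3]\setminus\{0\})\times\Lambda: T\in\lambda\}$, $E[3]$ respectively, with the natural inclusions $L^+\subset L\subset M$ and $L'\subset M$ and the corresponding norm maps. Identify $R\otimes_K R$ with $\operatorname{Map}_K(E[3]\times E[3],\overline K)$, and write $\overline R=\operatorname{Map}(E[3],\overline K)$, $\overline L=\operatorname{Map}(E[3]\setminus\{0\},\overline K)$ and $\partial\gamma(S,T)=\gamma(S)\gamma(T)/\gamma(S+T)$. Let $\xi\in H^1(K,E[3])$. An element $\alpha\in L^\times$ represents $w_1(\xi)\in L^\times/(L^\times)^3$ if there are a cocycle $(\sigma\mapsto\xi_\sigma)$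 representing $\xi$ and $\gamma\in\overline L^\times$ such that $e_3(\xi_\sigma,T)=(\sigma\gamma/\gamma)(T)$ for all $\sigma\in G_K$ and $T\ne 0$, and $\alpha\equiv\gamma^3 \bmod (L^\times)^3$. An element $\rho\in(R\otimes_K R)^\times$ represents $w_2(\xi)\in(R\otimes_K R)^\times/\partial R^\times$ if there are such a cocycle and $\gamma\in\overline R^\times$ with $e_3(\xi_\sigma,T)=(\sigma\gamma/\gamma)(T)$ for all $\sigma$ and $T\in E[3]$, and $\rho\equiv\partial\gamma\bmod\partial R^\times$. Such $\alpha$ and $\rho$ are compatible if a single cocycle representing $\xi$ and a single $\gamma\in\overline R^\times$ satisfy $e_3(\xi_\sigma,T)=(\sigma\gamma/\gamma)(T)$ for all $\sigma$ and $T\in E[3]$, $\gamma(0)=1$, $\gamma(T)^3=\alpha(T)$ for all $T\neq0$, and $\rho=\partial\gamma$. Proposition. Let $\xi\in H^1(K,E[3])$ and let $\alpha\in L^\times$ be a representative for $w_1(\xi)$. (i) There exist $r\in L^+$ and $s\in L'$ such that $$N_{L/L^+}(\alpha)=r^3,\quad N_{M/L'}(\alpha)=s^3,\quad \alpha N_{L^+/K}(r)=rN_{M/L}(s),\quad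 N_{L/K}(\alpha)=N_{L'/K}(s).$$ (ii) For any $r\in L^+$ and $s\in L'$ as in (i) there exists $\rho\in(R\otimes_K R)^\times$, a representative for $w_2(\xi)$ compatible with $\alpha$, such that $s(\lambda)=\rho(S_1,S_2)\rho(S_3,-S_3)$ for every $\lambda=\{S_1,S_2,S_3\}\in\Lambda$. -/

import Mathlib

noncomputable section

open scoped Pointwise

universe u

/-! ### Galois sets and their étale algebras -/

section Etale

variable (K : Type u) [Field K]

/-- The algebraic closure `K̄`. -/
abbrev KBar : Type u := AlgebraicClosure K

/-- The absolute Galois group `Gal(K̄/K)`, with the Krull topology. -/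
abbrev GalK : Type u := KBar K ≃ₐ[K] KBar K

/-- The étale algebra of a set `X` with Galois action: the `K`-algebra `Map_K(X, K̄)` of all Galois
equivariant maps from `X` to `K̄`. -/
def EtaleAlg (X : Type*) [MulAction (GalK K) X] : Subalgebra K (X → KBar K) where
  carrier := {f | ∀ (σ : GalK K) (x : X), f (σ • x) = σ (f x)}
  mul_mem' hf hg σ x := by simp [hf σ x, hg σ x]
  add_mem' hf hg σ x := by simp [hf σ x, hg σ x]
  algebraMap_mem' c σ x := by simp

variable {K}
variable {X Y : Type*} [MulAction (GalK K) X] [MulAction (GalK K) Y]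

/-- The homomorphism `Map_K(X, K̄) → Map_K(Y, K̄)`, `f ↦ f ∘ π`, induced by an equivariant map
`π : Y → X`. -/
def EtaleAlg.incl (π : Y →[GalK K] X) : EtaleAlg K X →ₐ[K] EtaleAlg K Y where
  toFun f := ⟨fun y => f.1 (π y), fun σ y => by
    change f.1 (π (σ • y)) = σ (f.1 (π y))
    rw [map_smul]
    exact f.2 σ (π y)⟩
  map_one' := rfl
  map_mul' _ _ := rfl
  map_zero' := rfl
  map_add' _ _ := rfl
  commutes' _ := rfl

/-- The norm `Map_K(Y, K̄) → Map_K(X, K̄)` along an equivariant map `π : Y → X` of finite sets: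
its value at `x` is the product of the values of `f` on the fibre `π⁻¹(x)`. (All the sets to which
this is applied are built from the finite group `E[3]`, so the products are finite.) -/
def EtaleAlg.norm (π : Y →[GalK K] X) (f : EtaleAlg K Y) : EtaleAlg K X :=
  ⟨fun x => ∏ᶠ y : {y : Y // π y = x}, f.1 y.1, fun σ x => by
    let e : {y : Y // π y = x} ≃ {y : Y // π y = σ • x} :=
      { toFun := fun y => ⟨σ • y.1, by rw [map_smul, y.2]⟩
        invFun := fun y => ⟨σ⁻¹ • y.1, by rw [map_smul, y.2, inv_smul_smul]⟩
        left_inv := fun y => Subtype.ext (inv_smul_smul σ y.1)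
        right_inv := fun y => Subtype.ext (smul_inv_smul σ y.1) }
    have h1 : (∏ᶠ y : {y : Y // π y = σ • x}, f.1 y.1)
        = ∏ᶠ y : {y : Y // π y = x}, f.1 (σ • y.1) :=
      (finprod_comp_equiv e (f := fun y : {y : Y // π y = σ • x} => f.1 y.1)).symm
    have h2 : σ (∏ᶠ y : {y : Y // π y = x}, f.1 y.1)
        = ∏ᶠ y : {y : Y // π y = x}, σ (f.1 y.1) :=
      MonoidHom.map_finprod_of_preimage_one (σ : KBar K →* KBar K)
        (fun a ha => by simpa using ha) _
    change (∏ᶠ y : {y : Y // π y = σ • x}, f.1 y.1) = σ (∏ᶠ y : {y : Y // π y = x}, f.1 y.1)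
    rw [h1, h2]
    exact finprod_congr fun y => f.2 σ y.1⟩

/-- The one-point Galois set; its étale algebra is `K` (see `algebraMap_etaleAlg_pt_bijective`). -/
inductive GalPt : Type
  | pt

instance : MulAction (GalK K) GalPt where
  smul _ x := x
  one_smul _ := rfl
  mul_smul _ _ _ := rfl

/-- The map from a Galois set to the one-point set. -/
def toPt (X : Type*) [MulAction (GalK K) X] : X →[GalK K] GalPt where
  toFun _ := GalPt.pt
  map_smul' _ _ := rfl

theorem algebraMap_etaleAlg_pt_bijective [CharZero K] :
    Function.Bijective (algebraMap K (EtaleAlg K GalPt)) := by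
  constructor
  · intro a b h
    exact (algebraMap K (KBar K)).injective (congrFun (congrArg Subtype.val h) GalPt.pt)
  · intro f
    obtain ⟨c, hc⟩ := (InfiniteGalois.mem_range_algebraMap_iff_fixed (k := K) (K := KBar K)
      (f.1 GalPt.pt)).2 fun σ => (f.2 σ GalPt.pt).symm
    exact ⟨c, Subtype.ext (funext fun x => by cases x; exact hc)⟩

end Etale

/-! ### Continuous Galois cohomology in degree one -/

section Cohomology

variable (K : Type u) [Field K] (A : Type*) [AddCommGroup A] [DistribMulAction (GalK K) A]

/-- Continuous 1-cocycles of `Gal(K̄/K)` with values in the discrete module `A`. -/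
def Z1 : AddSubgroup (GalK K → A) where
  carrier := {c | IsLocallyConstant c ∧ ∀ σ τ, c (σ * τ) = c σ + σ • c τ}
  zero_mem' := ⟨IsLocallyConstant.const 0, fun _ _ => by simp⟩
  add_mem' ha hb := ⟨ha.1.add hb.1, fun σ τ => by
    simp only [Pi.add_apply, ha.2 σ τ, hb.2 σ τ, smul_add]; abel⟩
  neg_mem' ha := ⟨ha.1.neg, fun σ τ => by
    simp only [Pi.neg_apply, ha.2 σ τ, smul_neg]; abel⟩

/-- The 1-coboundaries `σ ↦ σ a - a`, as a subgroup of the cocycles. -/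
def B1 : AddSubgroup (Z1 K A) where
  carrier := {c | ∃ a : A, ∀ σ, c.1 σ = σ • a - a}
  zero_mem' := ⟨0, fun _ => by simp⟩
  add_mem' := by
    rintro c d ⟨a, ha⟩ ⟨b, hb⟩
    refine ⟨a + b, fun σ => ?_⟩
    simp only [AddSubgroup.coe_add, Pi.add_apply, ha σ, hb σ, smul_add]; abel
  neg_mem' := by
    rintro c ⟨a, ha⟩
    refine ⟨-a, fun σ => ?_⟩
    simp only [AddSubgroup.coe_neg, Pi.neg_apply, ha σ, smul_neg]; abel

/-- `H¹(K, A)`. -/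
abbrev H1 := Z1 K A ⧸ B1 K A

end Cohomology

/-! ### Points and lines -/

section Lines

variable (K : Type u) [Field K] (A : Type*) [AddCommGroup A] [DistribMulAction (GalK K) A]

/-- The Galois set `A ∖ {0}`. -/
def NonzeroPts : SubMulAction (GalK K) A where
  carrier := {T | T ≠ 0}
  smul_mem' σ T hT := by
    simpa only [Set.mem_ofPred_eq, ne_eq, smul_eq_zero_iff_eq] using hT

variable {A}

/-- Lines of `A`, regarded as an affine space over `𝔽_p` when `pA = 0`: the sets
`{P + kQ : k}` with `Q ≠ 0`. -/
def IsLine (l : Set A) : Prop :=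
  ∃ P Q : A, Q ≠ 0 ∧ l = {x | ∃ k : ℤ, x = P + k • Q}

variable {K} in
theorem IsLine.smul {l : Set A} (hl : IsLine l) (σ : GalK K) : IsLine (σ • l) := by
  obtain ⟨P, Q, hQ, rfl⟩ := hl
  refine ⟨σ • P, σ • Q, by simpa only [ne_eq, smul_eq_zero_iff_eq] using hQ, ?_⟩
  ext x
  simp only [Set.mem_smul_set, Set.mem_ofPred_eq]
  constructor
  · rintro ⟨_, ⟨k, rfl⟩, rfl⟩
    exact ⟨k, by rw [smul_add, smul_comm σ k Q]⟩
  · rintro ⟨k, rfl⟩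
    exact ⟨_, ⟨k, rfl⟩, by rw [smul_add, smul_comm σ k Q]⟩

variable (A)

/-- `ℙ(A)`: the lines passing through `0`. -/
def LinesThroughZero : SubMulAction (GalK K) (Set A) where
  carrier := {l | IsLine l ∧ (0 : A) ∈ l}
  smul_mem' σ _ hl := ⟨hl.1.smul σ, ⟨0, hl.2, smul_zero σ⟩⟩

/-- `Λ`: the lines not passing through `0`. -/
def LinesNotThroughZero : SubMulAction (GalK K) (Set A) where
  carrier := {l | IsLine l ∧ (0 : A) ∉ l}
  smul_mem' σ l hl := ⟨hl.1.smul σ, fun h => hl.2 (by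
    obtain ⟨x, hx, h0⟩ := h
    have hx0 : x = 0 := (smul_eq_zero_iff_eq σ).1 h0
    exact hx0 ▸ hx)⟩

/-- The incident pairs `(T, l)` with `T ≠ 0`, `l ∈ Λ` and `T ∈ l`. -/
def IncidentPairs :
    SubMulAction (GalK K) (NonzeroPts K A × LinesNotThroughZero K A) where
  carrier := {x | x.1.1 ∈ x.2.1}
  smul_mem' _ x hx := ⟨x.1.1, hx, rfl⟩

/-- `T ↦` the line through `0` and `T`; it induces `L⁺ ⊂ L`. -/
def lineThrough : NonzeroPts K A →[GalK K] LinesThroughZero K A where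
  toFun T := ⟨{x | ∃ k : ℤ, x = 0 + k • T.1}, ⟨0, T.1, T.2, rfl⟩, ⟨0, by simp⟩⟩
  map_smul' σ T := by
    apply Subtype.ext
    change {x : A | ∃ k : ℤ, x = 0 + k • (σ • T.1)} = σ • {x : A | ∃ k : ℤ, x = 0 + k • T.1}
    ext x
    simp only [Set.mem_smul_set, Set.mem_ofPred_eq, zero_add]
    constructor
    · rintro ⟨k, rfl⟩
      exact ⟨_, ⟨k, rfl⟩, smul_comm σ k T.1⟩
    · rintro ⟨_, ⟨k, rfl⟩, rfl⟩
      exact ⟨k, smul_comm σ k T.1⟩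

/-- The projection `(T, l) ↦ T`; it induces `L ⊂ M`. -/
def incPoint : IncidentPairs K A →[GalK K] NonzeroPts K A where
  toFun x := x.1.1
  map_smul' _ _ := rfl

/-- The projection `(T, l) ↦ l`; it induces `L' ⊂ M`. -/
def incLine : IncidentPairs K A →[GalK K] LinesNotThroughZero K A where
  toFun x := x.1.2
  map_smul' _ _ := rfl

end Lines

/-! ### Torsion points and the Weil pairing -/

section Elliptic

variable {K : Type u} [Field K] (E : WeierstrassCurve K)

/-- The base change of `E` to `K̄`. -/
abbrev geomCurve : WeierstrassCurve.Affine (KBar K) := WeierstrassCurve.Affine.baseChange E (KBar K)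

/-- `E(K̄)`. -/
abbrev GeomPt : Type u := (geomCurve E).Point

instance : AddCommGroup (GeomPt E) :=
  letI := Classical.decEq (KBar K)
  WeierstrassCurve.Affine.Point.instAddCommGroup

/-- The Galois action on `E(K̄)`, on the coordinates of points. -/
instance : DistribMulAction (GalK K) (GeomPt E) :=
  letI := Classical.decEq (KBar K)
  { smul := fun σ P => WeierstrassCurve.Affine.Point.map (W' := E) (σ : KBar K →ₐ[K] KBar K) P
    one_smul := fun P => by cases P <;> rfl
    mul_smul := fun σ τ P => by cases P <;> rfl
    smul_zero := fun σ => map_zero (WeierstrassCurve.Affine.Point.map (W' := E) σ.toAlgHom)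
    smul_add := fun σ => map_add (WeierstrassCurve.Affine.Point.map (W' := E) σ.toAlgHom) }

/-- `E[n]`. -/
def Tors (n : ℕ) : AddSubgroup (GeomPt E) where
  carrier := {P | n • P = 0}
  zero_mem' := smul_zero n
  add_mem' {P Q} hP hQ := by
    change n • (P + Q) = 0
    rw [nsmul_add, hP, hQ, add_zero]
  neg_mem' {P} hP := by
    change n • (-P) = 0
    rw [smul_neg, hP, neg_zero]

instance (n : ℕ) : DistribMulAction (GalK K) (Tors E n) where
  smul σ P := ⟨σ • P.1, by
    change n • (σ • P.1) = 0
    rw [smul_comm, show n • P.1 = 0 from P.2, smul_zero]⟩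
  one_smul P := Subtype.ext (one_smul _ P.1)
  mul_smul σ τ P := Subtype.ext (mul_smul σ τ P.1)
  smul_zero σ := Subtype.ext (smul_zero σ)
  smul_add σ P Q := Subtype.ext (smul_add σ P.1 Q.1)

variable {E}

/-- The ideal of the affine coordinate ring `K̄[E]` of functions vanishing at `P`; it is the unit
ideal if `P` is the point at infinity. -/
def pointIdeal : GeomPt E → Ideal (geomCurve E).CoordinateRing
  | .zero => ⊤
  | .some x y _ => WeierstrassCurve.Affine.CoordinateRing.XYIdeal (geomCurve E) x (Polynomial.C y)

/-- The polynomial `f(X, Y)`, seen as a function on `E` without poles away from the point at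
infinity `O`, has divisor `n (P) - n (O)`. (The multiplicity at `O` is forced, the degree of a
principal divisor being zero.) -/
def HasDiv (n : ℕ) (P : GeomPt E) (f : Polynomial (Polynomial (KBar K))) : Prop :=
  Ideal.span {WeierstrassCurve.Affine.CoordinateRing.mk (geomCurve E) f} = pointIdeal P ^ n

/-- The value of `f(X, Y)` at an affine point. (The value given at infinity is never used.) -/
def valueAt (f : Polynomial (Polynomial (KBar K))) : GeomPt E → KBar K
  | .zero => 0
  | .some x y _ => f.evalEval x y

/-- `ζ` is the value of the Weil pairing `eₙ(S, T)`: if `div f_S = n (S) - n (O)` and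
`div f_T = n (T) - n (O)`, and `R` is a point different from `O`, `S`, `-T` and `S - T`, then
`eₙ(S, T) = (f_S(T + R) / f_S(R)) / (f_T(S - R) / f_T(-R))`,
which is independent of the choices of `f_S`, `f_T` and `R`. -/
def IsWeilValue (n : ℕ) (S T : GeomPt E) (ζ : KBar K) : Prop :=
  ∃ (fS fT : Polynomial (Polynomial (KBar K))) (R : GeomPt E), HasDiv n S fS ∧ HasDiv n T fT ∧
    R ≠ 0 ∧ R ≠ S ∧ R ≠ -T ∧ R ≠ S - T ∧
    ζ = (valueAt fS (T + R) / valueAt fS R) / (valueAt fT (S - R) / valueAt fT (-R))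

/-- The Weil pairing `eₙ` on `E[n]`. -/
def weilPairing {n : ℕ} (S T : Tors E n) : KBar K :=
  Classical.epsilon (IsWeilValue n S.1 T.1)

/-! ### Representatives of `w₁(ξ)` and `w₂(ξ)` -/

variable (E)

/-- `L`, the étale algebra of `E[n] ∖ {0}`. -/
abbrev AlgL (n : ℕ) := EtaleAlg K (NonzeroPts K (Tors E n))
/-- `L⁺`, the étale algebra of `ℙ(E[n])`. -/
abbrev AlgLPlus (n : ℕ) := EtaleAlg K (LinesThroughZero K (Tors E n))
/-- `L'`, the étale algebra of `Λ`. -/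
abbrev AlgLPrime (n : ℕ) := EtaleAlg K (LinesNotThroughZero K (Tors E n))
/-- `R`, the étale algebra of `E[n]`. -/
abbrev AlgR (n : ℕ) := EtaleAlg K (Tors E n)
/-- `R ⊗_K R`, the étale algebra of `E[n] × E[n]`. -/
abbrev AlgRR (n : ℕ) := EtaleAlg K (Tors E n × Tors E n)

variable {E}

/-- `α ∈ Lˣ` represents `w₁(ξ) ∈ Lˣ/(Lˣ)ⁿ`: there are a cocycle `c` representing `ξ` and `γ ∈ L̄ˣ`
with `w(c_σ) = σ(γ)/γ` for all `σ`, such that `α ≡ γⁿ mod (Lˣ)ⁿ`. -/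
def RepresentsW1 {n : ℕ} (ξ : H1 K (Tors E n)) (α : (AlgL E n)ˣ) : Prop :=
  ∃ (c : Z1 K (Tors E n)) (γ : NonzeroPts K (Tors E n) → (KBar K)ˣ) (b : (AlgL E n)ˣ),
    QuotientAddGroup.mk c = ξ ∧
    (∀ (σ : GalK K) (T : NonzeroPts K (Tors E n)),
      weilPairing (c.1 σ) T.1 = σ (γ (σ⁻¹ • T) : KBar K) / (γ T : KBar K)) ∧
    ∀ T, α.1.1 T = (γ T : KBar K) ^ n * b.1.1 T ^ n

/-- The map `∂ : R̄ˣ → Map(E[n] × E[n], K̄ˣ)`, `∂β(S, T) = β(S) β(T) / β(S + T)`. -/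
def partialMap {A M : Type*} [Add A] [DivInvMonoid M] (β : A → M) (x : A × A) : M :=
  β x.1 * β x.2 / β (x.1 + x.2)

/-- `ρ ∈ (R ⊗ R)ˣ` represents `w₂(ξ) ∈ (R ⊗ R)ˣ/∂Rˣ`: there are a cocycle `c` representing `ξ` and
`γ ∈ R̄ˣ` with `w(c_σ) = σ(γ)/γ` for all `σ`, such that `ρ ≡ ∂γ mod ∂Rˣ`. -/
def RepresentsW2 {n : ℕ} (ξ : H1 K (Tors E n)) (ρ : (AlgRR E n)ˣ) : Prop :=
  ∃ (c : Z1 K (Tors E n)) (γ : Tors E n → (KBar K)ˣ) (b : (AlgR E n)ˣ),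
    QuotientAddGroup.mk c = ξ ∧
    (∀ (σ : GalK K) (T : Tors E n),
      weilPairing (c.1 σ) T = σ (γ (σ⁻¹ • T) : KBar K) / (γ T : KBar K)) ∧
    ∀ x, ρ.1.1 x = ((partialMap γ x : (KBar K)ˣ) : KBar K) * partialMap b.1.1 x

/-- `α ∈ Lˣ` and `ρ ∈ (R ⊗ R)ˣ` are compatible representatives for `w₁(ξ)` and `w₂(ξ)`. -/
def Compatible {n : ℕ} (ξ : H1 K (Tors E n)) (α : (AlgL E n)ˣ) (ρ : (AlgRR E n)ˣ) : Prop :=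
  ∃ (c : Z1 K (Tors E n)) (γ : Tors E n → (KBar K)ˣ),
    QuotientAddGroup.mk c = ξ ∧
    (∀ (σ : GalK K) (T : Tors E n),
      weilPairing (c.1 σ) T = σ (γ (σ⁻¹ • T) : KBar K) / (γ T : KBar K)) ∧
    γ 0 = 1 ∧
    (∀ T : NonzeroPts K (Tors E n), (γ T.1 : KBar K) ^ n = α.1.1 T) ∧
    ∀ x, ρ.1.1 x = ((partialMap γ x : (KBar K)ˣ) : KBar K)

/-- The conditions `N_{L/L⁺}(α) = r³`, `N_{M/L'}(α) = s³`, `α N_{L⁺/K}(r) = r N_{M/L}(s)` and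
`N_{L/K}(α) = N_{L'/K}(s)`. The étale algebra of the one-point set stands for `K`. -/
def CubeRootConditions (α : AlgL E 3) (r : AlgLPlus E 3) (s : AlgLPrime E 3) : Prop :=
  EtaleAlg.norm (lineThrough K (Tors E 3)) α = r ^ 3 ∧
  EtaleAlg.norm (incLine K (Tors E 3)) (EtaleAlg.incl (incPoint K (Tors E 3)) α) = s ^ 3 ∧
  α * EtaleAlg.incl (toPt _) (EtaleAlg.norm (toPt _) r) =
    EtaleAlg.incl (lineThrough K (Tors E 3)) r *
      EtaleAlg.norm (incPoint K (Tors E 3)) (EtaleAlg.incl (incLine K (Tors E 3)) s) ∧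
  EtaleAlg.norm (toPt _) α = EtaleAlg.norm (toPt _) s

end Elliptic

end

/-! Absorbing the factor `b` into `γ` gives `γ³ = α` on nonzero points, with σ(γ(T)) = w_σ(σT) γ(σT)
and w_σ = e₃(ξ_σ, ·). As w_σ is a homomorphism, a product of values of `γ` over points of sum zero
is Galois equivariant. Both {T, -T} and any line of 𝔽₃² avoiding 0 have sum zero, so r₀ = γ(T)γ(-T)
and s₀(λ) = ∏_{T ∈ λ} γ(T) lie in L⁺ and L'. Counting incidences of points and lines gives the four
identities, hence (i).

For (ii), u = r/r₀ and t = s/s₀ have values in μ₃. It suffices to find a Galois equivariant ζ :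
E[3]∖{0} → μ₃ whose products over lines are t. Then γζ, extended by 1 at 0, has the same cube and
the same twist, its line products are s, and ρ = ∂(γζ) works because ρ(S₁,S₂)ρ(S₃,-S₃) telescopes
when S₁ + S₂ + S₃ = 0.

Equivariance of ζ is obtained by a canonical choice. Written additively over 𝔽₃, the even part of ζ
is -u. The odd part matters only modulo linear forms, whose sums over lines vanish. Odd functions
modulo linear forms have 9 classes, and each class has exactly one member supported on a single pair
±T (1 + 4·2 = 9). Its value at T is the common value of t(-λ)/t(λ) on the lines λ through T; where
these values disagree it is trivial. `sum_dot_eq` verifies this recipe, `prod_dot_eq` is its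
multiplicative form, and `correction` is the resulting ζ.

Of the Weil pairing only e₃(S, 0) = 1 and additivity in the second variable are needed. They come
from the geometry of flexes: the tangent line ℓ_S at S ∈ E[3] has divisor 3(S) - 3(O), and
`tangentVal_translate` compares translates of such lines. The count |E[3]| = 9 provides both the
coordinates 𝔽₃² and enough auxiliary points R. -/

noncomputable section

open scoped Pointwise

universe u

/-! ### Points of order three are flexes. -/

section FlexGeometry

open WeierstrassCurve WeierstrassCurve.Affine

variable {F : Type*} [Field F] {W : WeierstrassCurve.Affine F}

/-- The line of slope `l` through `(x₀, y₀)` is a flex tangent: in the coordinates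
`X = x - x₀`, `Y = y - y₀ - l (x - x₀)` the curve is `Y² + A₁XY + A₃Y = X³` with `A₃ ≠ 0`. -/
def IsFlex (W : WeierstrassCurve.Affine F) (x₀ y₀ l : F) : Prop :=
  2 * y₀ + W.a₁ * x₀ + W.a₃ ≠ 0 ∧ l ^ 2 + W.a₁ * l - W.a₂ = 3 * x₀ ∧ ∀ x y : F,
    y ^ 2 + W.a₁ * x * y + W.a₃ * y - (x ^ 3 + W.a₂ * x ^ 2 + W.a₄ * x + W.a₆) =
      (y - y₀ - l * (x - x₀)) ^ 2 + (W.a₁ + 2 * l) * (x - x₀) * (y - y₀ - l * (x - x₀)) +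
        (2 * y₀ + W.a₁ * x₀ + W.a₃) * (y - y₀ - l * (x - x₀)) - (x - x₀) ^ 3

theorem IsFlex.equation {x₀ y₀ l : F} (h : IsFlex W x₀ y₀ l) {x y : F} (hxy : W.Equation x y) :
    (y - y₀ - l * (x - x₀)) ^ 2 + (W.a₁ + 2 * l) * (x - x₀) * (y - y₀ - l * (x - x₀)) +
        (2 * y₀ + W.a₁ * x₀ + W.a₃) * (y - y₀ - l * (x - x₀)) = (x - x₀) ^ 3 := by
  have := h.2.2 x y
  rw [(equation_iff' x y).1 hxy] at this
  linear_combination -this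

variable [DecidableEq F]

theorem three_nsmul_eq_zero_iff {A : Type*} [AddCommGroup A] (P : A) :
    3 • P = 0 ↔ P + P = -P := by
  rw [succ_nsmul, two_nsmul, add_eq_zero_iff_eq_neg]

theorem Y_ne_negY_of_three_nsmul {x₀ y₀ : F} {h : W.Nonsingular x₀ y₀}
    (h3 : 3 • Point.some x₀ y₀ h = 0) : y₀ ≠ W.negY x₀ y₀ := by
  intro hy
  rw [three_nsmul_eq_zero_iff, Point.add_self_of_Y_eq hy] at h3
  exact Point.some_ne_zero h (neg_eq_zero.1 h3.symm)

theorem three_nsmul_some_eq_zero_iff {x₀ y₀ : F} {h : W.Nonsingular x₀ y₀} :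
    3 • Point.some x₀ y₀ h = 0 ↔
      y₀ ≠ W.negY x₀ y₀ ∧ W.addX x₀ x₀ (W.slope x₀ x₀ y₀ y₀) = x₀ := by
  constructor
  · intro h3
    have hy := Y_ne_negY_of_three_nsmul h3
    rw [three_nsmul_eq_zero_iff, Point.add_self_of_Y_ne hy, Point.neg_some] at h3
    exact ⟨hy, by injection h3⟩
  · rintro ⟨hy, hx⟩
    rw [three_nsmul_eq_zero_iff]
    have h2 : (Point.some x₀ y₀ h + Point.some x₀ y₀ h).xRep = (Point.some x₀ y₀ h).xRep := by
      rw [Point.add_self_of_Y_ne hy, Point.xRep_some, Point.xRep_some, hx]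
    refine (Point.eq_or_eq_neg_of_xRep_eq_xRep h2).resolve_left fun h' => ?_
    simp at h'

/-- If `3P = O`, the third intersection of the tangent at `P` with the curve is again `P`. Hence
`addPolynomial` for the tangent is minus the cube of `X - x₀`, and expanding this gives the flex
equation. -/
theorem isFlex_slope {x₀ y₀ : F} {h : W.Nonsingular x₀ y₀}
    (h3 : 3 • Point.some x₀ y₀ h = 0) : IsFlex W x₀ y₀ (W.slope x₀ x₀ y₀ y₀) := by
  obtain ⟨hy, hx⟩ := three_nsmul_some_eq_zero_iff.1 h3
  refine ⟨fun h' => hy (by rw [negY]; linear_combination h'),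
    by rw [addX] at hx; linear_combination hx, fun x y => ?_⟩
  have h4 := addPolynomial_slope h.1 h.1 (fun h => hy h.2)
  rw [hx] at h4
  have h5 := congrArg (Polynomial.eval x) h4
  simp [addPolynomial, linePolynomial, WeierstrassCurve.Affine.polynomial] at h5
  linear_combination h5

end FlexGeometry

/-! ### Tangent lines at flexes under translation by a flex. -/

section FlexTranslation

open WeierstrassCurve WeierstrassCurve.Affine

variable {F : Type*} [Field F] [DecidableEq F] {W : WeierstrassCurve.Affine F}

/-- The slope of the tangent line at an affine point. -/
abbrev tangentSlope (W : WeierstrassCurve.Affine F) (x y : F) : F := W.slope x x y y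

/-- The value at `R` of the function `y - y₀ - l (x - x₀)` defining the tangent line at
`S = (x₀, y₀)`, and the constant `1` for `S = O`. (The value at `R = O` is irrelevant.) -/
def tangentVal : W.Point → W.Point → F
  | .zero, _ => 1
  | .some _ _ _, .zero => 0
  | .some x₀ y₀ _, .some x y _ => y - y₀ - tangentSlope W x₀ y₀ * (x - x₀)

@[simp]
theorem tangentVal_zero_left (R : W.Point) : tangentVal 0 R = 1 := by
  rw [Point.zero_def, tangentVal]

@[simp]
theorem tangentVal_some_some {x₀ y₀ x y : F} (h₀ : W.Nonsingular x₀ y₀) (h : W.Nonsingular x y) :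
    tangentVal (.some x₀ y₀ h₀) (.some x y h) = y - y₀ - tangentSlope W x₀ y₀ * (x - x₀) := rfl

theorem tangentSlope_negY {x y : F} (h : y ≠ W.negY x y) :
    tangentSlope W x (W.negY x y) = -W.a₁ - tangentSlope W x y := by
  have h1 : y - W.negY x y ≠ 0 := sub_ne_zero.2 h
  have h2 : W.negY x y ≠ W.negY x (W.negY x y) := by rw [negY_negY]; exact h.symm
  have h3 : W.negY x y - y ≠ 0 := sub_ne_zero.2 h.symm
  rw [tangentSlope, tangentSlope, slope_of_Y_ne rfl h2, slope_of_Y_ne rfl h, negY_negY]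
  rw [← neg_sub y, div_neg]
  field_simp
  rw [negY]
  ring

/-- Lets the Weil quotient be rewritten with ℓ_{-T} in place of ℓ_T. The sign is harmless because it
occurs once in the numerator and once in the denominator. -/
theorem tangentVal_neg {T : W.Point} (hT : 3 • T = 0) {R : W.Point} (hR : R ≠ 0) :
    tangentVal (-T) R = (if T = 0 then 1 else -1) * tangentVal T (-R) := by
  obtain _ | ⟨x, y, h⟩ := T
  · simp only [← Point.zero_def]; simp
  obtain _ | ⟨x', y', h'⟩ := R
  · exact absurd rfl hR
  have hy := Y_ne_negY_of_three_nsmul hT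
  rw [if_neg (Point.some_ne_zero h)]
  simp only [Point.neg_some, tangentVal_some_some, tangentSlope_negY hy]
  simp only [negY]
  ring

/-- In flex coordinates `Y = 0` forces `X³ = 0`. -/
theorem tangentVal_eq_zero_iff {S R : W.Point} (hS : 3 • S = 0) (hS0 : S ≠ 0) (hR : R ≠ 0) :
    tangentVal S R = 0 ↔ R = S := by
  obtain _ | ⟨x₀, y₀, h₀⟩ := S
  · exact absurd rfl hS0
  obtain _ | ⟨x, y, h⟩ := R
  · exact absurd rfl hR
  have hf := (isFlex_slope hS).equation h.1
  rw [tangentVal_some_some]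
  constructor
  · intro hz
    rw [hz] at hf
    have hx : x = x₀ := by
      refine sub_eq_zero.1 (pow_eq_zero_iff (n := 3) (by norm_num) |>.1 ?_)
      linear_combination -hf
    subst hx
    have : y = y₀ := by linear_combination hz
    subst this
    rfl
  · intro h'
    injection h' with h1 h2
    subst h1 h2
    ring

/-- Translation by a flex, in flex coordinates. -/
theorem flex_translate {x₀ y₀ x y : F} {h₀ : W.Nonsingular x₀ y₀} {h : W.Nonsingular x y}
    (hT : 3 • Point.some x₀ y₀ h₀ = 0) (hR : Point.some x y h ≠ -Point.some x₀ y₀ h₀)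
    {l A₁ A₃ X Y : F} (hl : l = tangentSlope W x₀ y₀) (hA₁ : A₁ = W.a₁ + 2 * l)
    (hA₃ : A₃ = 2 * y₀ + W.a₁ * x₀ + W.a₃) (hX : X = x - x₀) (hY : Y = y - y₀ - l * X) :
    ∃ (x' y' : F) (h' : W.Nonsingular x' y'),
      Point.some x₀ y₀ h₀ + Point.some x y h = Point.some x' y' h' ∧
      (x' - x₀) * (Y + A₁ * X + A₃) = -A₃ * X ∧
      (y' - y₀ - l * (x' - x₀)) * (Y + A₁ * X + A₃) = -A₃ ^ 2 := by
  have hflex := isFlex_slope hT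
  have heq : Y ^ 2 + A₁ * X * Y + A₃ * Y = X ^ 3 := by
    rw [hY, hX, hA₁, hA₃, hl]; exact hflex.equation h.1
  by_cases hx : x₀ = x
  -- Equal abscissas with `R ≠ -T` leave only `R = T`, where `X = Y = 0` and `T + T = -T`.
  · have hyy : y₀ = y := by
      by_contra hne
      refine hR ?_
      have := (Point.eq_or_eq_neg_of_xRep_eq_xRep (P := Point.some x y h)
        (Q := Point.some x₀ y₀ h₀) (by simp [hx]))
      refine this.resolve_left fun h' => hne ?_
      injection h' with h1 h2
      exact h2.symm
    subst hx hyy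
    refine ⟨x₀, W.negY x₀ y₀, (nonsingular_neg ..).2 h₀, ?_, ?_, ?_⟩
    · rw [(three_nsmul_eq_zero_iff _).1 hT, Point.neg_some]
    · rw [hX]; ring
    · rw [hY, hX, hA₃, negY]; ring
  · have hX0 : X ≠ 0 := by rw [hX]; exact sub_ne_zero.2 (Ne.symm hx)
    refine ⟨_, _, _, Point.add_of_X_ne hx, ?_, ?_⟩
    all_goals
      have hs : W.slope x₀ x y₀ y = l + Y / X := by
        rw [slope_of_X_ne hx, ← neg_sub x, ← neg_sub y, neg_div_neg_eq, ← hX, hY]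
        field_simp
        ring
      have hX' : W.addX x₀ x (W.slope x₀ x y₀ y) - x₀ = -A₃ * Y / X ^ 2 := by
        rw [hs, addX]
        have := hflex.2.1
        rw [← tangentSlope, ← hl] at this
        have hx' : x = X + x₀ := by rw [hX]; ring
        rw [hx', hA₁] at *
        field_simp
        linear_combination X ^ 2 * this + heq
    · rw [hX']
      field_simp
      linear_combination -A₃ * heq
    · have hY' : W.addY x₀ x y₀ (W.slope x₀ x y₀ y) - y₀ -
          l * (W.addX x₀ x (W.slope x₀ x y₀ y) - x₀) = -A₃ ^ 2 * Y / X ^ 3 := by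
        have : W.addX x₀ x (W.slope x₀ x y₀ y) = -A₃ * Y / X ^ 2 + x₀ := by
          rw [← hX']; ring
        rw [addY, negAddY, negY, this, hs, show W.a₃ = A₃ - 2 * y₀ - W.a₁ * x₀ by rw [hA₃]; ring,
          show W.a₁ = A₁ - 2 * l by rw [hA₁]; ring]
        field_simp
        linear_combination A₃ * heq
      rw [hY']
      field_simp
      linear_combination -A₃ ^ 2 * heq

/-- A line through a flex which meets the curve at no other point is the tangent line. -/
theorem eq_tangentSlope_of_unique [IsAlgClosed F] [W.IsElliptic] {x₀ y₀ k : F}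
    {h₀ : W.Nonsingular x₀ y₀} (hT : 3 • Point.some x₀ y₀ h₀ = 0)
    (hk : ∀ x y, W.Equation x y → y = y₀ + k * (x - x₀) → x = x₀) : k = tangentSlope W x₀ y₀ := by
  have hflex := isFlex_slope hT
  set l := tangentSlope W x₀ y₀ with hl
  -- Putting `Y = (k - l) X` in the flex equation and dividing by `X` leaves this quadratic. By
  -- hypothesis its root is 0, so its constant term A₃(k - l) vanishes.
  obtain ⟨X, hX⟩ : ∃ X : F, X ^ 2 - ((k - l) ^ 2 + (W.a₁ + 2 * l) * (k - l)) * X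
      - (2 * y₀ + W.a₁ * x₀ + W.a₃) * (k - l) = 0 := by
    obtain ⟨X, hX⟩ := IsAlgClosed.exists_root (Polynomial.X ^ 2
      - Polynomial.C ((k - l) ^ 2 + (W.a₁ + 2 * l) * (k - l)) * Polynomial.X
      - Polynomial.C ((2 * y₀ + W.a₁ * x₀ + W.a₃) * (k - l))) (by
        have : (Polynomial.X ^ 2
          - Polynomial.C ((k - l) ^ 2 + (W.a₁ + 2 * l) * (k - l)) * Polynomial.X
          - Polynomial.C ((2 * y₀ + W.a₁ * x₀ + W.a₃) * (k - l))).degree = 2 := by compute_degree!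
        rw [this]; norm_num)
    exact ⟨X, by simpa [Polynomial.IsRoot] using hX⟩
  have hx := hk (x₀ + X) (y₀ + k * X) (by
    rw [equation_iff', hflex.2.2, ← tangentSlope, ← hl]
    linear_combination -X * hX) (by ring)
  have hX0 : X = 0 := by linear_combination hx
  rw [hX0] at hX
  have : (2 * y₀ + W.a₁ * x₀ + W.a₃) * (k - l) = 0 := by linear_combination -hX
  exact sub_eq_zero.1 ((mul_eq_zero.1 this).resolve_left hflex.1)

/-- Up to a constant, `R ↦ ℓ_S(T + R) ℓ_{-T}(R)` is `ℓ_{S - T}`, for `ℓ_P` the equation of the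
tangent line at a flex `P`. -/
theorem tangentVal_translate [IsAlgClosed F] [W.IsElliptic] {S T : W.Point} (hS : 3 • S = 0)
    (hT : 3 • T = 0) :
    ∃ c : F, c ≠ 0 ∧ ∀ R : W.Point, R ≠ 0 → R ≠ -T →
      tangentVal S (T + R) * tangentVal (-T) R = c * tangentVal (S - T) R := by
  -- In terms of divisors: R ↦ ℓ_S(T + R) has divisor 3(S - T) - 3(-T), and ℓ_{-T} cancels the pole
  -- at -T.
  by_cases hS0 : S = 0
  · subst hS0
    exact ⟨1, one_ne_zero, fun R _ _ => by simp⟩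
  by_cases hT0 : T = 0
  · subst hT0
    exact ⟨1, one_ne_zero, fun R _ _ => by simp⟩
  have hsub : 3 • (S - T) = 0 := by rw [smul_sub, hS, hT, sub_zero]
  by_cases hST : S - T = 0
  all_goals
    obtain _ | ⟨x₀, y₀, h₀⟩ := T
    · exact absurd rfl hT0
    obtain _ | ⟨x₁, y₁, h₁⟩ := S
    · exact absurd rfl hS0
    have hflex := isFlex_slope hT
    have hyT := Y_ne_negY_of_three_nsmul hT
    obtain ⟨l, hl⟩ : ∃ l, l = tangentSlope W x₀ y₀ := ⟨_, rfl⟩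
    obtain ⟨A₁, hA₁⟩ : ∃ A, A = W.a₁ + 2 * l := ⟨_, rfl⟩
    obtain ⟨A₃, hA₃⟩ : ∃ A, A = 2 * y₀ + W.a₁ * x₀ + W.a₃ := ⟨_, rfl⟩
    have hA0 : A₃ ≠ 0 := hA₃ ▸ hflex.1
    -- The denominator in `flex_translate` is exactly ℓ_{-T}(R), so the product is an affine-linear
    -- function of the coordinates of `R`.
    have hlhs : ∀ (x y : F) (h : W.Nonsingular x y),
        Point.some x y h ≠ -Point.some x₀ y₀ h₀ →
        tangentVal (.some x₁ y₁ h₁) (.some x₀ y₀ h₀ + .some x y h) *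
          tangentVal (-.some x₀ y₀ h₀) (.some x y h) =
        -A₃ ^ 2 + (tangentSlope W x₁ y₁ - l) * A₃ * (x - x₀) +
          tangentVal (.some x₁ y₁ h₁) (.some x₀ y₀ h₀) *
          ((y - y₀ - l * (x - x₀)) + A₁ * (x - x₀) + A₃) := by
      intro x y h hne
      obtain ⟨x', y', h', hadd, hX, hY⟩ := flex_translate hT hne hl hA₁ hA₃ rfl rfl
      rw [hadd, tangentVal_some_some, Point.neg_some, tangentVal_some_some, tangentSlope_negY hyT,
        ← hl, tangentVal_some_some,
        show y - W.negY x₀ y₀ - (-W.a₁ - l) * (x - x₀) =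
          (y - y₀ - l * (x - x₀)) + A₁ * (x - x₀) + A₃ by rw [negY, hA₁, hA₃]; ring]
      linear_combination hY - (tangentSlope W x₁ y₁ - l) * hX
  · refine ⟨-A₃ ^ 2, by simpa using hA0, fun R hR hRT => ?_⟩
    have heq := sub_eq_zero.1 hST
    obtain _ | ⟨x, y, h⟩ := R
    · exact absurd rfl hR
    rw [hlhs x y h hRT, hST, tangentVal_zero_left, (tangentVal_eq_zero_iff hS hS0 hT0).2 heq.symm]
    injection heq with h1 h2
    subst h1 h2
    rw [hl]
    ring
  · set n := tangentVal (.some x₁ y₁ h₁) (.some x₀ y₀ h₀) with hn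
    have hn0 : n ≠ 0 := fun h => hST (by
      rw [(tangentVal_eq_zero_iff hS hS0 hT0).1 h, sub_self])
    refine ⟨n, hn0, fun R hR hRT => ?_⟩
    obtain ⟨U, hU⟩ : ∃ U, U = Point.some x₁ y₁ h₁ - Point.some x₀ y₀ h₀ := ⟨_, rfl⟩
    rw [← hU] at hST hsub ⊢
    have hUT : U ≠ -Point.some x₀ y₀ h₀ := fun h => hS0 (by
      rw [hU, sub_eq_neg_self] at h; exact h)
    have hTU : Point.some x₀ y₀ h₀ + U = Point.some x₁ y₁ h₁ := by rw [hU]; abel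
    obtain _ | ⟨x₂, y₂, h₂⟩ := U
    · exact absurd rfl hST
    have hzero := hlhs x₂ y₂ h₂ hUT
    rw [hTU, (tangentVal_eq_zero_iff hS hS0 hS0).2 rfl, zero_mul] at hzero
    -- The affine-linear function vanishes at U = S - T, so it is `n` times the equation of a line
    -- through `U`; `k` is the slope of that line.
    obtain ⟨k, hk⟩ : ∃ k, n * (k - l) = -(n * A₁ + (tangentSlope W x₁ y₁ - l) * A₃) :=
      ⟨l - (n * A₁ + (tangentSlope W x₁ y₁ - l) * A₃) / n, by field_simp; ring⟩
    have hline : ∀ x y : F, -A₃ ^ 2 + (tangentSlope W x₁ y₁ - l) * A₃ * (x - x₀) +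
          n * ((y - y₀ - l * (x - x₀)) + A₁ * (x - x₀) + A₃) = n * (y - y₂ - k * (x - x₂)) := by
      intro x y
      linear_combination -hzero + (x - x₂) * hk
    have hkl : k = tangentSlope W x₂ y₂ := by
      -- The line meets the curve only at `U`: away from -T a zero of the product means `T + R = S`,
      -- and at -T the linear function equals -A₃² ≠ 0.
      refine eq_tangentSlope_of_unique hsub fun x y hxy hlin => ?_
      have hns := equation_iff_nonsingular.1 hxy
      have hl0 := hline x y
      rw [show n * (y - y₂ - k * (x - x₂)) = 0 by rw [hlin]; ring] at hl0
      by_cases hneg : Point.some x y hns = -Point.some x₀ y₀ h₀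
      · rw [Point.neg_some] at hneg
        injection hneg with hx hy
        rw [hx, hy, negY, hA₁, sub_self] at hl0
        exact absurd (pow_eq_zero_iff (two_ne_zero) |>.1 (show A₃ ^ 2 = 0 by
          rw [hA₃] at *; linear_combination -hl0)) hA0
      · have h4 := hlhs x y hns hneg
        rw [hl0, mul_eq_zero, tangentVal_eq_zero_iff hS hS0,
          tangentVal_eq_zero_iff (by rw [smul_neg, hT, neg_zero]) (neg_ne_zero.2 hT0)
            (Point.some_ne_zero hns)] at h4
        · have h5 := h4.resolve_right hneg
          rw [← hTU, add_right_inj] at h5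
          injection h5
        · exact fun h => hneg (eq_neg_of_add_eq_zero_right h)
    obtain _ | ⟨x, y, h⟩ := R
    · exact absurd rfl hR
    rw [hlhs x y h hRT, hline, tangentVal_some_some, hkl]

end FlexTranslation

/-! ### Functions with divisor 3(S) - 3(O) are multiples of the tangent line. -/

section FlexIdeal

open WeierstrassCurve WeierstrassCurve.Affine WeierstrassCurve.Affine.CoordinateRing Polynomial
open scoped Polynomial.Bivariate

variable {F : Type*} [Field F] {W : WeierstrassCurve.Affine F}

/-- The units of the affine coordinate ring are the nonzero constants. -/
theorem exists_const_of_isUnit {u : W.CoordinateRing} (hu : IsUnit u) :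
    ∃ c : F, c ≠ 0 ∧ u = mk W (C (C c)) := by
  obtain ⟨p, q, rfl⟩ := exists_smul_basis_eq u
  have h := degree_eq_zero_of_isUnit (hu.map (Algebra.norm F[X]))
  -- The norm of p + qY has degree max(2 deg p, 2 deg q + 3). For a unit this is 0, so `q = 0` and
  -- `p` is constant.
  rw [degree_norm_smul_basis] at h
  have hq : q = 0 := by
    by_contra hq
    have h1 : 2 • q.degree + 3 ≤ 0 := h ▸ le_max_right _ _
    rw [degree_eq_natDegree hq] at h1
    have : ((2 * q.natDegree + 3 : ℕ) : WithBot ℕ) ≤ ((0 : ℕ) : WithBot ℕ) := by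
      simpa [two_nsmul, two_mul] using h1
    have := Nat.cast_le.1 this
    omega
  have hp : p.degree ≤ 0 := by
    by_contra hp
    have h1 : 2 • p.degree ≤ 0 := h ▸ le_max_left _ _
    have hp0 : p ≠ 0 := by rintro rfl; simp at hp
    rw [degree_eq_natDegree hp0] at h1 hp
    have : ((2 * p.natDegree : ℕ) : WithBot ℕ) ≤ ((0 : ℕ) : WithBot ℕ) := by
      simpa [two_nsmul, two_mul] using h1
    have := Nat.cast_le.1 this
    exact hp (by rw [show p.natDegree = 0 by omega]; simp)
  obtain ⟨c, rfl⟩ : ∃ c, p = C c := ⟨_, eq_C_of_degree_le_zero hp⟩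
  refine ⟨c, ?_, by rw [hq, zero_smul, add_zero, CoordinateRing.smul, mul_one]⟩
  rintro rfl
  simp [hq] at h

theorem evalEval_eq_of_mk_eq {f g : F[X][Y]} (h : mk W f = mk W g) {x y : F}
    (hxy : W.Equation x y) : f.evalEval x y = g.evalEval x y := by
  obtain ⟨k, hk⟩ := AdjoinRoot.mk_eq_mk.1 h
  rw [← sub_eq_zero, ← evalEval_sub, hk, evalEval_mul, show W.polynomial.evalEval x y = 0 from hxy,
    zero_mul]

theorem evalEval_of_span_eq {f g : F[X][Y]}
    (h : Ideal.span {mk W f} = Ideal.span {mk W g}) :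
    ∃ c : F, c ≠ 0 ∧ ∀ x y : F, W.Equation x y → f.evalEval x y = c * g.evalEval x y := by
  obtain ⟨u, hu⟩ := Ideal.span_singleton_eq_span_singleton.1 h.symm
  obtain ⟨c, hc0, hc⟩ := exists_const_of_isUnit u.isUnit
  refine ⟨c, hc0, fun x y hxy => ?_⟩
  rw [hc, ← map_mul] at hu
  rw [← evalEval_eq_of_mk_eq hu hxy, evalEval_mul, mul_comm]
  simp [evalEval]

variable [DecidableEq F]

/-- The cube of the maximal ideal of a flex is generated by the equation of the tangent line. -/
theorem XYIdeal_pow_three {x₀ y₀ : F} {h : W.Nonsingular x₀ y₀}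
    (hT : 3 • Point.some x₀ y₀ h = 0) :
    XYIdeal W x₀ (C y₀) ^ 3 =
      Ideal.span {mk W (Y - C (linePolynomial x₀ y₀ (tangentSlope W x₀ y₀)))} := by
  obtain ⟨hy, hx⟩ := three_nsmul_some_eq_zero_iff.1 hT
  have hflex := isFlex_slope hT
  rw [XYIdeal_eq₁ x₀ y₀ (tangentSlope W x₀ y₀)]
  set l := tangentSlope W x₀ y₀ with hl
  set a := XClass W x₀ with ha
  set b := YClass W (linePolynomial x₀ y₀ l) with hb
  change XYIdeal W x₀ (linePolynomial x₀ y₀ l) ^ 3 = Ideal.span {b}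
  set A₁ := mk W (C (C (W.a₁ + 2 * l)))
  set A₃ := mk W (C (C (2 * y₀ + W.a₁ * x₀ + W.a₃))) with hA₃
  have hrel : b ^ 2 + A₁ * a * b + A₃ * b = a ^ 3 := by
    have h1 := CoordinateRing.C_addPolynomial_slope h.1 h.1 (fun h => hy h.2)
    rw [hx, CoordinateRing.C_addPolynomial, ← tangentSlope, ← hl] at h1
    have h2 : W.negPolynomial - C (linePolynomial x₀ y₀ l) =
        -((Y - C (linePolynomial x₀ y₀ l)) + C (C (W.a₁ + 2 * l)) * C (X - C x₀) +
          C (C (2 * y₀ + W.a₁ * x₀ + W.a₃))) := by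
      simp only [negPolynomial, linePolynomial]
      simp only [map_ofNat, C_add, C_sub, C_mul]
      ring
    rw [h2] at h1
    simp only [map_mul, map_neg, map_add (CoordinateRing.mk W)] at h1
    change b * -(b + A₁ * a + A₃) = -(a * a * a) at h1
    linear_combination -h1
  have hI : XYIdeal W x₀ (linePolynomial x₀ y₀ l) = Ideal.span {a, b} := rfl
  rw [hI]
  set I := Ideal.span {a, b} with hI'
  have haI : a ∈ I := Ideal.subset_span (by simp)
  have hbI : b ∈ I := Ideal.subset_span (by simp)
  -- By `hrel`, a³ = b(b + A₁a + A₃); every other monomial of degree three in `a`, `b` visibly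
  -- contains `b`.
  apply le_antisymm
  · have hJ : ∀ x ∈ I, ∃ p q, x = p * a + q * b := fun x hx => by
      obtain ⟨p, q, h⟩ := Ideal.mem_span_pair.1 hx
      exact ⟨p, q, h.symm⟩
    rw [pow_succ, pow_two, Ideal.mul_le]
    intro r hr s hs
    refine Submodule.mul_induction_on hr (fun m hm n hn => ?_) (fun m n hm hn => ?_)
    · obtain ⟨p₁, q₁, rfl⟩ := hJ m hm
      obtain ⟨p₂, q₂, rfl⟩ := hJ n hn
      obtain ⟨p₃, q₃, rfl⟩ := hJ s hs
      rw [Ideal.mem_span_singleton']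
      refine ⟨p₁ * p₂ * p₃ * (b + A₁ * a + A₃) + q₁ * (p₂ * a + q₂ * b) * (p₃ * a + q₃ * b) +
        p₁ * a * q₂ * (p₃ * a + q₃ * b) + p₁ * a * p₂ * a * q₃, ?_⟩
      linear_combination p₁ * p₂ * p₃ * hrel
    · rw [add_mul]; exact add_mem hm hn
  · rw [Ideal.span_singleton_le_iff_mem]
    have hunit : ∀ (J : Ideal W.CoordinateRing), A₃ * b ∈ J → b ∈ J := by
      intro J hJ
      have : mk W (C (C (2 * y₀ + W.a₁ * x₀ + W.a₃)⁻¹)) * A₃ = 1 := by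
        rw [hA₃, ← map_mul, ← C_mul, ← C_mul, inv_mul_cancel₀ hflex.1, C_1, C_1, map_one]
      rw [← one_mul b, ← this, mul_assoc]
      exact J.mul_mem_left _ hJ
    have hA : A₃ * b = a ^ 3 - b ^ 2 - A₁ * (a * b) := by linear_combination hrel
    -- Bootstrapping with A₃b = a³ - b² - A₁ab and A₃ invertible: first `b ∈ I²`, hence b² and ab
    -- lie in `I³`, hence `b ∈ I³`.
    have hb2 : b ∈ I ^ 2 := hunit _ (by
      rw [hA]
      refine sub_mem (sub_mem (Ideal.pow_le_pow_right (by norm_num) (Ideal.pow_mem_pow haI 3))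
        (Ideal.pow_mem_pow hbI 2)) (Ideal.mul_mem_left _ _ ?_)
      rw [pow_two]; exact Ideal.mul_mem_mul haI hbI)
    refine hunit _ ?_
    rw [hA]
    refine sub_mem (sub_mem (Ideal.pow_mem_pow haI 3) ?_) (Ideal.mul_mem_left _ _ ?_)
    · rw [pow_two, pow_succ]; exact Ideal.mul_mem_mul hb2 hbI
    · rw [pow_succ, mul_comm]; exact Ideal.mul_mem_mul haI hb2

end FlexIdeal

/-! ### The nine points of E[3], by means of the division polynomial Ψ₃. -/

section ThreeTorsion

open WeierstrassCurve WeierstrassCurve.Affine Polynomial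

variable {F : Type*} [Field F] {W : WeierstrassCurve.Affine F}

theorem eval_Ψ₃ (W : WeierstrassCurve.Affine F) (x : F) :
    W.Ψ₃.eval x = 3 * x ^ 4 + W.b₂ * x ^ 3 + 3 * W.b₄ * x ^ 2 + 3 * W.b₆ * x + W.b₈ := by
  simp [WeierstrassCurve.Ψ₃]

/-- The right side involves the numerator and denominator of the tangent slope. If the denominator
vanished at a root of Ψ₃, so would the numerator, making the point singular; otherwise Ψ₃ measures
the difference between x(2P) and x(P). -/
theorem eval_Ψ₃_of_equation {x y : F} (h : W.Equation x y) :
    W.Ψ₃.eval x = -((3 * x ^ 2 + 2 * W.a₂ * x + W.a₄ - W.a₁ * y) ^ 2 +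
      W.a₁ * (3 * x ^ 2 + 2 * W.a₂ * x + W.a₄ - W.a₁ * y) * (2 * y + W.a₁ * x + W.a₃) -
      (W.a₂ + 3 * x) * (2 * y + W.a₁ * x + W.a₃) ^ 2) := by
  rw [equation_iff'] at h
  rw [eval_Ψ₃, b₂, b₄, b₆, b₈]
  linear_combination -(12 * x + W.a₁ ^ 2 + 4 * W.a₂) * h

theorem two_y_ne_zero_of_eval_Ψ₃ {x y : F} (h : W.Nonsingular x y) (hx : W.Ψ₃.eval x = 0) :
    2 * y + W.a₁ * x + W.a₃ ≠ 0 := by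
  intro hd
  rw [eval_Ψ₃_of_equation h.1, hd] at hx
  have hn : 3 * x ^ 2 + 2 * W.a₂ * x + W.a₄ - W.a₁ * y = 0 :=
    pow_eq_zero_iff two_ne_zero |>.1 (by linear_combination -hx)
  rcases (nonsingular_iff' x y).1 h with ⟨-, h1 | h1⟩
  · exact h1 (by linear_combination -hn)
  · exact h1 hd

theorem three_nsmul_some_iff_eval_Ψ₃ [DecidableEq F] {x y : F} {h : W.Nonsingular x y} :
    3 • Point.some x y h = 0 ↔ W.Ψ₃.eval x = 0 := by
  have hd : 2 * y + W.a₁ * x + W.a₃ = y - W.negY x y := by rw [negY]; ring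
  have key : y ≠ W.negY x y → W.Ψ₃.eval x =
      -(W.addX x x (W.slope x x y y) - x) * (y - W.negY x y) ^ 2 := fun hy => by
    have hd0 : y - W.negY x y ≠ 0 := sub_ne_zero.2 hy
    rw [eval_Ψ₃_of_equation h.1, hd, slope_of_Y_ne rfl hy, addX]
    field_simp
    ring
  rw [three_nsmul_some_eq_zero_iff]
  constructor
  · rintro ⟨hy, hx⟩
    rw [key hy, hx, sub_self, neg_zero, zero_mul]
  · intro hx
    have hd0 := two_y_ne_zero_of_eval_Ψ₃ h hx
    rw [hd] at hd0
    refine ⟨sub_ne_zero.1 hd0, ?_⟩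
    rw [key (sub_ne_zero.1 hd0)] at hx
    exact sub_eq_zero.1 (neg_eq_zero.1 ((mul_eq_zero.1 hx).resolve_right (pow_ne_zero 2 hd0)))

variable [IsAlgClosed F]

theorem exists_equation (W : WeierstrassCurve.Affine F) (x : F) : ∃ y, W.Equation x y := by
  obtain ⟨y, hy⟩ := IsAlgClosed.exists_root (X ^ 2 + C (W.a₁ * x + W.a₃) * X
    - C (x ^ 3 + W.a₂ * x ^ 2 + W.a₄ * x + W.a₆)) (by
      have : (X ^ 2 + C (W.a₁ * x + W.a₃) * X
        - C (x ^ 3 + W.a₂ * x ^ 2 + W.a₄ * x + W.a₆)).degree = 2 := by compute_degree!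
      rw [this]; norm_num)
  refine ⟨y, (equation_iff' x y).2 ?_⟩
  have : y ^ 2 + (W.a₁ * x + W.a₃) * y - (x ^ 3 + W.a₂ * x ^ 2 + W.a₄ * x + W.a₆) = 0 := by
    simpa [IsRoot] using hy
  linear_combination this

/-- On the curve the derivative of Ψ₃ is 3(2y + a₁x + a₃)², which does not vanish at a root of Ψ₃.
-/
theorem nodup_roots_Ψ₃ [W.IsElliptic] (h3 : (3 : F) ≠ 0) : W.Ψ₃.roots.Nodup := by
  classical
  rw [Multiset.nodup_iff_count_le_one]
  intro x
  rw [count_roots]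
  by_contra! hlt
  have h0 : W.Ψ₃ ≠ 0 := by rintro h; simp [h] at hlt
  obtain ⟨h2, h1⟩ := (one_lt_rootMultiplicity_iff_isRoot h0).1 hlt
  obtain ⟨y, hy⟩ := exists_equation W x
  have hns := equation_iff_nonsingular.1 hy
  refine two_y_ne_zero_of_eval_Ψ₃ hns h2 (pow_eq_zero_iff (n := 2) two_ne_zero |>.1 ?_)
  have h4 : 3 * (4 * x ^ 3 + W.b₂ * x ^ 2 + 2 * W.b₄ * x + W.b₆) = 0 := by
    have : (derivative W.Ψ₃).eval x = 0 := h1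
    simp [WeierstrassCurve.Ψ₃] at this
    linear_combination this
  have h5 := (mul_eq_zero.1 h4).resolve_left h3
  rw [b₂, b₄, b₆] at h5
  rw [equation_iff'] at hy
  linear_combination h5 + 4 * hy

theorem card_roots_Ψ₃ [W.IsElliptic] [DecidableEq F] (h3 : (3 : F) ≠ 0) :
    W.Ψ₃.roots.toFinset.card = 4 := by
  rw [Multiset.toFinset_card_of_nodup (nodup_roots_Ψ₃ h3),
    IsAlgClosed.card_roots_eq_natDegree, WeierstrassCurve.natDegree_Ψ₃ _ h3]

/-- An elliptic curve over an algebraically closed field of characteristic not `3` has nine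
`3`-torsion points. -/
theorem exists_finset_three_torsion [W.IsElliptic] [DecidableEq F] (h3 : (3 : F) ≠ 0) :
    ∃ s : Finset W.Point, s.card = 9 ∧ ∀ P, P ∈ s ↔ 3 • P = 0 := by
  classical
  have hΨ : W.Ψ₃ ≠ 0 := by
    intro h
    have := card_roots_Ψ₃ (W := W) h3
    simp [h] at this
  have hex : ∀ x ∈ W.Ψ₃.roots.toFinset, ∃ P : W.Point, 3 • P = 0 ∧ P ≠ 0 ∧ P.xRep = ![x, 1] := by
    intro x hx
    obtain ⟨y, hy⟩ := exists_equation W x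
    have hns := equation_iff_nonsingular.1 hy
    refine ⟨.some x y hns, three_nsmul_some_iff_eval_Ψ₃.2 ?_, Point.some_ne_zero hns, by simp⟩
    simpa [hΨ] using hx
  choose! P hP3 hP0 hPx using hex
  have hne : ∀ x ∈ W.Ψ₃.roots.toFinset, P x ≠ -P x := fun x hx h => hP0 x hx (by
    have h1 := (three_nsmul_eq_zero_iff _).1 (hP3 x hx)
    rw [← h] at h1
    simpa using h1)
  have hdisj : ∀ x ∈ W.Ψ₃.roots.toFinset, ∀ y ∈ W.Ψ₃.roots.toFinset, x ≠ y →
      Disjoint ({P x, -P x} : Finset W.Point) {P y, -P y} := by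
    intro x hx y hy hxy
    rw [Finset.disjoint_left]
    intro Q hQ hQ'
    have hQx : Q.xRep = ![x, 1] := by
      rcases Finset.mem_insert.1 hQ with rfl | h
      · exact hPx x hx
      · rw [Finset.mem_singleton.1 h, Point.xRep_neg, hPx x hx]
    have hQy : Q.xRep = ![y, 1] := by
      rcases Finset.mem_insert.1 hQ' with rfl | h
      · exact hPx y hy
      · rw [Finset.mem_singleton.1 h, Point.xRep_neg, hPx y hy]
    exact hxy (congrFun (hQx.symm.trans hQy) 0)
  have hU0 : ∀ x ∈ W.Ψ₃.roots.toFinset, ∀ Q ∈ ({P x, -P x} : Finset W.Point),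
      3 • Q = 0 ∧ Q ≠ 0 := by
    intro x hx Q hQ
    rcases Finset.mem_insert.1 hQ with rfl | h
    · exact ⟨hP3 x hx, hP0 x hx⟩
    · rw [Finset.mem_singleton.1 h, smul_neg, neg_eq_zero, neg_ne_zero]
      exact ⟨hP3 x hx, hP0 x hx⟩
  -- Each of the four roots carries one pair ±P: 1 + 4·2 = 9.
  refine ⟨insert 0 (W.Ψ₃.roots.toFinset.biUnion fun x => {P x, -P x}), ?_, fun Q => ?_⟩
  · rw [Finset.card_insert_of_notMem, Finset.card_biUnion hdisj,
      Finset.sum_congr rfl fun x hx => Finset.card_pair (hne x hx), Finset.sum_const,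
      card_roots_Ψ₃ h3]
    · norm_num
    · intro h
      obtain ⟨x, hx, hQ⟩ := Finset.mem_biUnion.1 h
      exact (hU0 x hx 0 hQ).2 rfl
  · rw [Finset.mem_insert, Finset.mem_biUnion]
    constructor
    · rintro (rfl | ⟨x, hx, hQ⟩)
      · exact smul_zero 3
      · exact (hU0 x hx Q hQ).1
    · intro hQ
      refine or_iff_not_imp_left.2 fun hQ0 => ?_
      obtain _ | ⟨x, y, h⟩ := Q
      · exact absurd rfl hQ0
      have hx : x ∈ W.Ψ₃.roots.toFinset := by
        simpa [hΨ] using three_nsmul_some_iff_eval_Ψ₃.1 hQ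
      refine ⟨x, hx, ?_⟩
      have := Point.eq_or_eq_neg_of_xRep_eq_xRep
        (show (Point.some x y h).xRep = (P x).xRep by rw [hPx x hx, Point.xRep_some])
      simpa using this

end ThreeTorsion

/-! ### The Weil pairing through tangent lines, and its additivity. -/

section WeilPairing

open WeierstrassCurve WeierstrassCurve.Affine

/-- The quotient `(ℓ_S(T + R) / ℓ_S(R)) / (ℓ_T(S - R) / ℓ_T(-R))` of values of tangent lines. -/
def tangentQuot {F : Type*} [Field F] [DecidableEq F] {W : WeierstrassCurve.Affine F}
    (S T R : W.Point) : F :=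
  (tangentVal S (T + R) / tangentVal S R) / (tangentVal T (S - R) / tangentVal T (-R))

section

variable {F : Type*} [Field F] [DecidableEq F] {W : WeierstrassCurve.Affine F}

theorem tangentVal_ne_zero {S R : W.Point} (hS : 3 • S = 0) (hR : R ≠ 0) (hRS : R ≠ S) :
    tangentVal S R ≠ 0 := by
  by_cases hS0 : S = 0
  · rw [hS0, tangentVal_zero_left]; exact one_ne_zero
  · exact fun h => hRS ((tangentVal_eq_zero_iff hS hS0 hR).1 h)

theorem tangentQuot_eq {S T R : W.Point} (hT : 3 • T = 0)
    (hR0 : R ≠ 0) (hRS : R ≠ S) :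
    tangentQuot S T R = (tangentVal S (T + R) * tangentVal (-T) R) /
      (tangentVal S R * tangentVal (-T) (R - S)) := by
  have hε : (if T = 0 then (1 : F) else -1) ≠ 0 := by split_ifs <;> simp
  rw [tangentQuot, tangentVal_neg hT hR0, tangentVal_neg hT (sub_ne_zero.2 hRS), neg_sub]
  rw [div_div_div_eq, mul_left_comm, mul_left_comm (tangentVal S R), mul_div_mul_left _ _ hε]

variable [IsAlgClosed F] [W.IsElliptic]

/-- `tangentVal_translate` for (S, T) and for (-T, -S) makes numerator and denominator in
`tangentQuot_eq` constant multiples of the same ℓ_{S-T}(R). -/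
theorem exists_tangentQuot_eq {S T : W.Point} (hS : 3 • S = 0) (hT : 3 • T = 0) :
    ∃ v : F, ∀ R : W.Point, R ≠ 0 → R ≠ S → R ≠ -T → R ≠ S - T → tangentQuot S T R = v := by
  obtain ⟨c, hc, h⟩ := tangentVal_translate hS hT
  obtain ⟨d, hd, h'⟩ := tangentVal_translate (S := -T) (T := -S) (by rw [smul_neg, hT, neg_zero])
    (by rw [smul_neg, hS, neg_zero])
  refine ⟨c / d, fun R hR hRS hRT hRST => ?_⟩
  have h2 := h' R hR (by rwa [neg_neg])
  rw [neg_neg, neg_add_eq_sub, neg_sub_neg] at h2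
  rw [tangentQuot_eq hT hR hRS, h R hR hRT, mul_comm (tangentVal S R), h2]
  exact mul_div_mul_right _ _
    (tangentVal_ne_zero (by rw [smul_sub, hS, hT, sub_zero]) hR hRST)

/-- The values of ℓ_S telescope along R, T + R, T + T' + R. The remaining factors combine by
`tangentVal_translate` for (-T', T), taken at `R` and at `R - S`, where the same constant cancels.
-/
theorem tangentQuot_add {S T T' R : W.Point} (hS : 3 • S = 0) (hT : 3 • T = 0) (hT' : 3 • T' = 0)
    (hR : R ≠ 0) (hRS : R ≠ S) (hRT : R ≠ -T) (hRST : R ≠ S - T) (hRSTT : R ≠ S - T - T') :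
    tangentQuot S (T + T') R = tangentQuot S T R * tangentQuot S T' (T + R) := by
  have hnT : 3 • (-T) = 0 := by rw [smul_neg, hT, neg_zero]
  have hnT' : 3 • (-T') = 0 := by rw [smul_neg, hT', neg_zero]
  have hTT' : 3 • (T + T') = 0 := by rw [smul_add, hT, hT', add_zero]
  have hTR : T + R ≠ 0 := fun h => hRT (eq_neg_of_add_eq_zero_right h)
  have hTRS : T + R ≠ S := fun h => hRST (by rw [← h]; abel)
  have hRS0 : R - S ≠ 0 := sub_ne_zero.2 hRS
  have hRST' : R - S ≠ -T := fun h => hRST (by rw [sub_eq_iff_eq_add.1 h]; abel)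
  have hRSTT' : R - S ≠ -T - T' := fun h => hRSTT (by rw [sub_eq_iff_eq_add.1 h]; abel)
  obtain ⟨c, hc, h⟩ := tangentVal_translate hnT' hT
  have h1 := h R hR hRT
  have h2 := h (R - S) hRS0 hRST'
  rw [tangentQuot_eq hTT' hR hRS, tangentQuot_eq hT hR hRS, tangentQuot_eq hT' hTR hTRS,
    show T' + (T + R) = T + T' + R by abel, show -(T + T') = -T' - T by abel,
    show T + R - S = T + (R - S) by abel]
  have n1 := tangentVal_ne_zero hS hTR hTRS
  have n2 := tangentVal_ne_zero hS hR hRS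
  have n3 := tangentVal_ne_zero hnT hRS0 hRST'
  have n4 : tangentVal (-T') (T + (R - S)) ≠ 0 := tangentVal_ne_zero hnT'
    (fun h => hRST (by rw [show R = T + (R - S) + S - T by abel, h]; abel))
    (fun h => hRSTT (by rw [show R = T + (R - S) + S - T by abel, h]; abel))
  have n5 : tangentVal (-T' - T) (R - S) ≠ 0 :=
    tangentVal_ne_zero (by rw [smul_sub, hnT', hT, sub_zero]) hRS0
      (by rwa [show -T' - T = -T - T' by abel])
  rw [← mul_div_mul_left _ _ hc, mul_left_comm, ← h1, mul_left_comm c, ← h2]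
  field_simp

theorem exists_three_torsion_notMem (h3 : (3 : F) ≠ 0) (s : Finset W.Point) (hs : s.card < 9) :
    ∃ R : W.Point, R ∉ s := by
  obtain ⟨t, ht, -⟩ := exists_finset_three_torsion (W := W) h3
  obtain ⟨R, -, hR⟩ := Finset.exists_mem_notMem_of_card_lt_card (s := s) (t := t) (by omega)
  exact ⟨R, hR⟩

end

section

variable {K : Type u} [Field K] {E : WeierstrassCurve K}

/-- The same choice as in the group structure on `GeomPt E`, so that general results on points apply
to it. -/
instance : DecidableEq (KBar K) := Classical.decEq _

theorem hasDiv_zero : HasDiv (E := E) 3 0 1 := by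
  rw [HasDiv, map_one, Ideal.span_singleton_one]
  exact (Ideal.top_pow _ 3).symm

theorem hasDiv_tangent {x y : KBar K} {h : (geomCurve E).Nonsingular x y}
    (hS : 3 • Point.some x y h = 0) :
    HasDiv 3 (Point.some x y h : GeomPt E)
      (Polynomial.X - Polynomial.C (linePolynomial x y (tangentSlope (geomCurve E) x y))) :=
  (XYIdeal_pow_three hS).symm

theorem exists_hasDiv {S : (geomCurve E).Point} (hS : 3 • S = 0) :
    ∃ f : Polynomial (Polynomial (KBar K)), HasDiv 3 S f := by
  obtain _ | ⟨x, y, h⟩ := S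
  · exact ⟨_, hasDiv_zero⟩
  · exact ⟨_, hasDiv_tangent hS⟩

theorem HasDiv.exists_eq {S : (geomCurve E).Point} (hS : 3 • S = 0)
    {f : Polynomial (Polynomial (KBar K))} (hf : HasDiv 3 S f) :
    ∃ c : KBar K, c ≠ 0 ∧ ∀ R : (geomCurve E).Point, R ≠ 0 →
      valueAt f R = c * tangentVal S R := by
  obtain _ | ⟨x₀, y₀, h₀⟩ := S
  · obtain ⟨c, hc, h⟩ := evalEval_of_span_eq (W := geomCurve E) (f := f) (g := 1)
      (Eq.trans hf (hasDiv_zero (E := E)).symm)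
    refine ⟨c, hc, fun R hR => ?_⟩
    obtain _ | ⟨x, y, hxy⟩ := R
    · exact absurd rfl hR
    · rw [← Point.zero_def, tangentVal_zero_left, valueAt, h x y hxy.1]
      simp [Polynomial.evalEval]
  · obtain ⟨c, hc, h⟩ := evalEval_of_span_eq (W := geomCurve E) (f := f)
      (Eq.trans hf (hasDiv_tangent hS).symm)
    refine ⟨c, hc, fun R hR => ?_⟩
    obtain _ | ⟨x, y, hxy⟩ := R
    · exact absurd rfl hR
    · rw [tangentVal_some_some, valueAt, h x y hxy.1]
      simp [Polynomial.evalEval, linePolynomial]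
      ring_nf
      simp

theorem HasDiv.quot_eq {S T R : (geomCurve E).Point} (hS : 3 • S = 0)
    (hT : 3 • T = 0) {fS fT : Polynomial (Polynomial (KBar K))} (hfS : HasDiv 3 S fS)
    (hfT : HasDiv 3 T fT) (hR0 : R ≠ 0) (hRS : R ≠ S) (hRT : R ≠ -T) :
    (valueAt fS (T + R) / valueAt fS R) / (valueAt fT (S - R) / valueAt fT (-R)) =
      tangentQuot S T R := by
  obtain ⟨c, hc, h⟩ := hfS.exists_eq hS
  obtain ⟨d, hd, h'⟩ := hfT.exists_eq hT
  rw [h _ hR0, h _ (fun h => hRT (eq_neg_of_add_eq_zero_right h)), h' _ (neg_ne_zero.2 hR0),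
    h' _ (sub_ne_zero.2 hRS.symm), mul_div_mul_left _ _ hc, mul_div_mul_left _ _ hd, tangentQuot]

instance [E.IsElliptic] : WeierstrassCurve.IsElliptic (geomCurve E) :=
  inferInstanceAs (WeierstrassCurve.IsElliptic (E.map (algebraMap K (KBar K))))

variable [E.IsElliptic]

/-- Whatever functions and auxiliary point `Classical.epsilon` selects, the constants cancel
(`HasDiv.quot_eq`) and the point is immaterial (`exists_tangentQuot_eq`). -/
theorem weilPairing_eq_tangentQuot (S T : Tors E 3) {R : (geomCurve E).Point} (hR0 : R ≠ 0)
    (hRS : R ≠ S.1) (hRT : R ≠ -T.1) (hRST : R ≠ S.1 - T.1) :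
    weilPairing S T = tangentQuot (W := geomCurve E) S.1 T.1 R := by
  obtain ⟨v, hv⟩ := exists_tangentQuot_eq (W := geomCurve E) S.2 T.2
  obtain ⟨fS, hfS⟩ := exists_hasDiv S.2
  obtain ⟨fT, hfT⟩ := exists_hasDiv T.2
  have hex : ∃ ζ, IsWeilValue 3 S.1 T.1 ζ :=
    ⟨_, fS, fT, R, hfS, hfT, hR0, hRS, hRT, hRST, rfl⟩
  obtain ⟨gS, gT, R', hgS, hgT, hR0', hRS', hRT', hRST', h⟩ := Classical.epsilon_spec hex
  rw [weilPairing, h, hgS.quot_eq S.2 T.2 hgT hR0' hRS' hRT', hv R' hR0' hRS' hRT' hRST',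
    hv R hR0 hRS hRT hRST]

variable [CharZero K]

theorem three_ne_zero_KBar : (3 : KBar K) ≠ 0 := by
  have : CharZero (KBar K) := charZero_of_injective_algebraMap (algebraMap K (KBar K)).injective
  norm_num

theorem weilPairing_add_right (S T T' : Tors E 3) :
    weilPairing S (T + T') = weilPairing S T * weilPairing S T' := by
  -- The auxiliary point may itself be 3-torsion: the three quotients exclude at most six of nine
  -- points.
  obtain ⟨R, hR⟩ := exists_three_torsion_notMem (W := geomCurve E) three_ne_zero_KBar
    {0, S.1, -T.1, S.1 - T.1, -T.1 - T'.1, S.1 - T.1 - T'.1}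
    (Finset.card_le_six.trans_lt (by norm_num))
  simp only [Finset.mem_insert, Finset.mem_singleton, not_or] at hR
  obtain ⟨hR, hRS, hRT, hRST, hRTT, hRSTT⟩ := hR
  rw [weilPairing_eq_tangentQuot S (T + T') (R := R) hR hRS ?_ ?_,
    weilPairing_eq_tangentQuot S T hR hRS hRT hRST,
    weilPairing_eq_tangentQuot S T' (R := T.1 + R) ?_ ?_ ?_ ?_]
  · exact tangentQuot_add S.2 T.2 T'.2 hR hRS hRT hRST hRSTT
  · exact fun h => hRT (eq_neg_of_add_eq_zero_right h)
  · exact fun h => hRST (eq_sub_of_add_eq' h)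
  · exact fun h => hRTT (by rw [sub_eq_neg_add, ← h]; abel)
  · exact fun h => hRSTT (by rw [sub_right_comm, ← h]; abel)
  · exact fun h => hRTT (by rw [h]; change -(T.1 + T'.1) = _; abel)
  · exact fun h => hRSTT (by rw [h]; change S.1 - (T.1 + T'.1) = _; abel)

theorem weilPairing_zero_right (S : Tors E 3) : weilPairing S 0 = 1 := by
  obtain ⟨R, hR⟩ := exists_three_torsion_notMem (W := geomCurve E) three_ne_zero_KBar {0, S.1}
    (Finset.card_le_two.trans_lt (by norm_num))
  simp only [Finset.mem_insert, Finset.mem_singleton, not_or] at hR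
  have h0 : ((0 : Tors E 3) : (geomCurve E).Point) = 0 := rfl
  have hS : R ≠ S.1 - ((0 : Tors E 3) : (geomCurve E).Point) := by rw [h0, sub_zero]; exact hR.2
  have h0' : R ≠ -((0 : Tors E 3) : (geomCurve E).Point) := by rw [h0, neg_zero]; exact hR.1
  rw [weilPairing_eq_tangentQuot S 0 hR.1 hR.2 h0' hS, h0, tangentQuot, zero_add,
    div_self (tangentVal_ne_zero S.2 hR.1 hR.2), tangentVal_zero_left, tangentVal_zero_left,
    div_one, div_one]

theorem card_tors_three : Nat.card (Tors E 3) = 9 := by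
  obtain ⟨s, hs, h⟩ := exists_finset_three_torsion (W := geomCurve E) three_ne_zero_KBar
  rw [← hs, ← Nat.card_eq_finsetCard]
  exact Nat.card_congr (Equiv.subtypeEquivRight fun P => (h P).symm)

end

end WeilPairing

/-! ### Coordinates: nonzero points are nonzero vectors `v`, lines avoiding 0 are nonzero forms `φ`,
incidence is `φ.dot v = 1`. -/

section Coordinates

/-- The plane `𝔽₃²`. -/
abbrev Plane3 : Type := ZMod 3 × ZMod 3

/-- The standard pairing on `𝔽₃²`. -/
def Plane3.dot (φ v : Plane3) : ZMod 3 := φ.1 * v.1 + φ.2 * v.2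

/-- The canonical direction of the line `φ = 1`. -/
theorem Plane3.dot_eq_one_iff : ∀ φ : Plane3, φ ≠ 0 → ∀ v : Plane3, φ.dot v = 1 ↔
    ∃ k : ZMod 3, v = (φ.dot φ * φ.1, φ.dot φ * φ.2) + (k * -φ.2, k * φ.1) := by
  unfold Plane3.dot; decide

/-- The form is det(P, Q) · det(·, Q): it kills the direction `Q`, and since det(P, Q) = ±1 it takes
the value 1 at `P`. -/
theorem Plane3.exists_dot_iff : ∀ P Q : Plane3, Q ≠ 0 → (∀ k : ZMod 3, P + (k * Q.1, k * Q.2) ≠ 0) →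
    ∃ φ : Plane3, φ ≠ 0 ∧ ∀ v : Plane3, (∃ k : ZMod 3, v = P + (k * Q.1, k * Q.2)) ↔
      φ.dot v = 1 := by
  rintro ⟨p, p'⟩ ⟨q, q'⟩ hQ h
  have h1 : ∀ p p' q q' : ZMod 3, (q, q') ≠ (0 : Plane3) →
      (∀ k : ZMod 3, (p, p') + (k * q, k * q') ≠ (0 : Plane3)) →
      (((p * q' - p' * q) * q', (p * q' - p' * q) * -q) : Plane3) ≠ 0 := by decide
  have h2 : ∀ p p' q q' : ZMod 3, (q, q') ≠ (0 : Plane3) →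
      (∀ k : ZMod 3, (p, p') + (k * q, k * q') ≠ (0 : Plane3)) →
      ∀ v : Plane3, (∃ k : ZMod 3, v = (p, p') + (k * q, k * q')) ↔
        (p * q' - p' * q) * q' * v.1 + (p * q' - p' * q) * -q * v.2 = 1 := by decide
  exact ⟨_, h1 p p' q q' hQ h, h2 p p' q q' hQ h⟩

theorem Plane3.dot_ext : ∀ φ ψ : Plane3, (∀ v, φ.dot v = 1 ↔ ψ.dot v = 1) → φ = ψ := by
  unfold Plane3.dot; decide

theorem Plane3.eq_or_eq_neg : ∀ v w : Plane3, v ≠ 0 →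
    ((∃ k : ZMod 3, v = (k * w.1, k * w.2)) ↔ v = w ∨ v = -w) := by
  decide

theorem zsmul_plane3 (k : ℤ) (v : Plane3) : k • v = ((k : ZMod 3) * v.1, (k : ZMod 3) * v.2) :=
  Prod.ext (zsmul_eq_mul _ _) (zsmul_eq_mul _ _)

theorem exists_int_iff_zmod {n : ℕ} {p : ZMod n → Prop} : (∃ k : ℤ, p k) ↔ ∃ k : ZMod n, p k :=
  ⟨fun ⟨k, h⟩ => ⟨k, h⟩, fun ⟨k, h⟩ => by
    obtain ⟨m, rfl⟩ := ZMod.intCast_surjective k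
    exact ⟨m, h⟩⟩

/-- A group of exponent `3` and order `9` is isomorphic to `𝔽₃²`. -/
theorem exists_addEquiv_plane3 {A : Type*} [AddCommGroup A] (h3 : ∀ a : A, 3 • a = 0)
    (hA : Nat.card A = 9) : Nonempty (A ≃+ Plane3) := by
  let _ : Module (ZMod 3) A := AddCommGroup.zmodModule h3
  have : Finite A := Nat.finite_of_card_ne_zero (by omega)
  have : Fact (Nat.Prime 3) := ⟨Nat.prime_three⟩
  have h : Module.finrank (ZMod 3) A = 2 := by
    have := Module.natCard_eq_pow_finrank (K := ZMod 3) (V := A)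
    rw [hA, Nat.card_zmod, show 9 = 3 ^ 2 by norm_num] at this
    exact (Nat.pow_right_injective (by norm_num : 2 ≤ 3) this).symm
  exact ⟨(LinearEquiv.ofFinrankEq A Plane3 (by rw [h]; simp)).toAddEquiv⟩

variable {K : Type u} [Field K] {A : Type*} [AddCommGroup A] [DistribMulAction (GalK K) A]
variable (e : A ≃+ Plane3)

variable (K) in
/-- The nonzero point with the given coordinates. -/
def ptOf (v : Plane3) (hv : v ≠ 0) : NonzeroPts K A :=
  ⟨e.symm v, fun h => hv (by simpa using h)⟩

variable (K) in
/-- The line `φ = 1`. -/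
def lnOf (φ : Plane3) (hφ : φ ≠ 0) : LinesNotThroughZero K A :=
  ⟨{a | φ.dot (e a) = 1}, by
    refine ⟨⟨e.symm (φ.dot φ * φ.1, φ.dot φ * φ.2), e.symm (-φ.2, φ.1), ?_, ?_⟩, ?_⟩
    · intro h
      apply hφ
      have h' : (-φ.2, φ.1) = (0 : Plane3) := by simpa using h
      exact Prod.ext (congrArg Prod.snd h') (by simpa using congrArg Prod.fst h')
    · ext a
      change φ.dot (e a) = 1 ↔ ∃ k : ℤ, _
      rw [Plane3.dot_eq_one_iff φ hφ, ← exists_int_iff_zmod]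
      refine exists_congr fun k => ?_
      rw [← e.injective.eq_iff, map_add, map_zsmul, e.apply_symm_apply, e.apply_symm_apply,
        zsmul_plane3]
    · change ¬ (φ.dot (e 0) = 1)
      simp [Plane3.dot]⟩

variable (K) in
theorem ptOf_surjective (T : NonzeroPts K A) : ∃ (v : Plane3) (hv : v ≠ 0), ptOf K e v hv = T :=
  ⟨e T.1, fun h => T.2 (by simpa using h), Subtype.ext (e.symm_apply_apply _)⟩

theorem lnOf_surjective (l : LinesNotThroughZero K A) :
    ∃ (φ : Plane3) (hφ : φ ≠ 0), lnOf K e φ hφ = l := by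
  obtain ⟨l, ⟨P, Q, hQ, rfl⟩, h0⟩ := l
  obtain ⟨φ, hφ, h⟩ := Plane3.exists_dot_iff (e P) (e Q) (by simpa using hQ) (by
    rw [← not_exists_not]
    simp only [not_not]
    rw [← exists_int_iff_zmod]
    rintro ⟨k, hk⟩
    refine h0 ⟨k, e.injective ?_⟩
    rw [map_zero, map_add, map_zsmul, zsmul_plane3, hk])
  refine ⟨φ, hφ, Subtype.ext (Set.ext fun a => ?_)⟩
  change φ.dot (e a) = 1 ↔ ∃ k : ℤ, _
  rw [← h, ← exists_int_iff_zmod]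
  refine exists_congr fun k => ?_
  rw [← e.injective.eq_iff, map_add, map_zsmul, zsmul_plane3]

theorem lnOf_inj {φ ψ : Plane3} {hφ : φ ≠ 0} {hψ : ψ ≠ 0} :
    lnOf K e φ hφ = lnOf K e ψ hψ ↔ φ = ψ := by
  refine ⟨fun h => Plane3.dot_ext _ _ fun v => ?_, fun h => by subst h; rfl⟩
  have := Set.ext_iff.1 (congrArg Subtype.val h) (e.symm v)
  simpa [lnOf] using! this

theorem ptOf_mem_lnOf {v φ : Plane3} {hv : v ≠ 0} {hφ : φ ≠ 0} :
    (ptOf K e v hv).1 ∈ (lnOf K e φ hφ).1 ↔ φ.dot v = 1 := by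
  change φ.dot (e (e.symm v)) = 1 ↔ _
  rw [e.apply_symm_apply]

theorem lineThrough_ptOf_eq_iff {v w : Plane3} {hv : v ≠ 0} {hw : w ≠ 0} :
    lineThrough K A (ptOf K e v hv) = lineThrough K A (ptOf K e w hw) ↔ v = w ∨ v = -w := by
  have key : ∀ {v w : Plane3} {hv : v ≠ 0} {hw : w ≠ 0},
      (ptOf K e v hv).1 ∈ (lineThrough K A (ptOf K e w hw)).1 ↔ v = w ∨ v = -w := by
    intro v w hv hw
    rw [← Plane3.eq_or_eq_neg v w hv, ← exists_int_iff_zmod]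
    refine exists_congr fun k => ?_
    rw [zero_add, ← e.injective.eq_iff, map_zsmul]
    change e (e.symm v) = k • e (e.symm w) ↔ _
    rw [e.apply_symm_apply, e.apply_symm_apply, zsmul_plane3]
  constructor
  · intro h
    refine key.1 (h ▸ key.2 (Or.inl rfl) : (ptOf K e v hv).1 ∈ (lineThrough K A (ptOf K e w hw)).1)
  · rintro (rfl | rfl)
    · rfl
    · refine Subtype.ext (Set.ext fun a => ?_)
      change (∃ k : ℤ, a = 0 + k • e.symm (-w)) ↔ ∃ k : ℤ, a = 0 + k • e.symm w
      simp only [map_neg, smul_neg]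
      exact ⟨fun ⟨k, h⟩ => ⟨-k, by rw [h, neg_smul]⟩,
        fun ⟨k, h⟩ => ⟨-k, by rw [h, neg_smul, neg_neg]⟩⟩

theorem lineThrough_surjective (l : LinesThroughZero K A) :
    ∃ T : NonzeroPts K A, lineThrough K A T = l := by
  obtain ⟨l, ⟨P, Q, hQ, rfl⟩, m, hm⟩ := l
  refine ⟨⟨Q, hQ⟩, Subtype.ext (Set.ext fun a => ?_)⟩
  have hP : P = -(m • Q) := eq_neg_of_add_eq_zero_left hm.symm
  change (∃ k : ℤ, a = 0 + k • Q) ↔ ∃ k : ℤ, a = P + k • Q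
  subst hP
  exact ⟨fun ⟨k, h⟩ => ⟨k + m, by rw [h, add_smul]; abel⟩,
    fun ⟨k, h⟩ => ⟨k - m, by rw [h, sub_smul]; abel⟩⟩

end Coordinates

/-! ### The norm maps as finite products in coordinates. -/

section Norms

variable {K : Type u} [Field K] {A : Type*} [AddCommGroup A] [DistribMulAction (GalK K) A]
variable (e : A ≃+ Plane3) {M : Type*} [CommMonoid M]

/-- A function on nonzero points in coordinates, extended by the value `1` at `0`. -/
def ptFun (f : NonzeroPts K A → M) (v : Plane3) : M :=
  if h : v = 0 then 1 else f (ptOf K e v h)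

/-- A function on lines not through `0` in coordinates, extended by the value `1` at `0`. -/
def lnFun (g : LinesNotThroughZero K A → M) (φ : Plane3) : M :=
  if h : φ = 0 then 1 else g (lnOf K e φ h)

theorem ptFun_of_ne (f : NonzeroPts K A → M) {v : Plane3} (h : v ≠ 0) :
    ptFun e f v = f (ptOf K e v h) := dif_neg h

theorem lnFun_of_ne (g : LinesNotThroughZero K A → M) {φ : Plane3} (h : φ ≠ 0) :
    lnFun e g φ = g (lnOf K e φ h) := dif_neg h

@[simp] theorem ptFun_zero (f : NonzeroPts K A → M) : ptFun e f 0 = 1 := dif_pos rfl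

@[simp] theorem lnFun_zero (g : LinesNotThroughZero K A → M) : lnFun e g 0 = 1 := dif_pos rfl

theorem Plane3.left_ne_zero {φ v : Plane3} (h : φ.dot v = 1) : φ ≠ 0 := by
  rintro rfl; simp [Plane3.dot] at h

theorem Plane3.right_ne_zero {φ v : Plane3} (h : φ.dot v = 1) : v ≠ 0 := by
  rintro rfl; simp [Plane3.dot] at h

theorem prod_ite_eq_prod_subtype {ι : Type*} [Fintype ι] (p : ι → Prop) [DecidablePred p]
    (f : ι → M) : (∏ i, if p i then f i else 1) = ∏ i : {i // p i}, f i := by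
  rw [← Finset.prod_filter]
  exact Finset.prod_subtype _ (by simp) f

theorem finprod_incLine {φ : Plane3} (hφ : φ ≠ 0) (f : NonzeroPts K A → M) :
    (∏ᶠ y : {y : IncidentPairs K A // incLine K A y = lnOf K e φ hφ}, f (incPoint K A y.1)) =
      ∏ v : Plane3, if φ.dot v = 1 then ptFun e f v else 1 := by
  rw [prod_ite_eq_prod_subtype, ← finprod_eq_prod_of_fintype]
  refine (finprod_eq_of_bijective (fun v : {v : Plane3 // φ.dot v = 1} =>
    (⟨⟨(ptOf K e v.1 (Plane3.right_ne_zero v.2), lnOf K e φ hφ),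
      (ptOf_mem_lnOf e (hv := Plane3.right_ne_zero v.2) (hφ := hφ)).2 v.2⟩, rfl⟩ :
      {y : IncidentPairs K A // incLine K A y = lnOf K e φ hφ})) ⟨?_, ?_⟩ ?_).symm
  · intro v w h
    exact Subtype.ext (e.symm.injective (congrArg
      (fun y : {y : IncidentPairs K A // incLine K A y = lnOf K e φ hφ} => (incPoint K A y.1).1) h))
  · rintro ⟨⟨⟨T, l⟩, hT⟩, rfl : l = _⟩
    obtain ⟨v, hv, rfl⟩ := ptOf_surjective K e T
    exact ⟨⟨v, (ptOf_mem_lnOf e (hv := hv) (hφ := hφ)).1 hT⟩, rfl⟩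
  · intro v
    exact ptFun_of_ne e f (Plane3.right_ne_zero v.2)

theorem finprod_incPoint {v : Plane3} (hv : v ≠ 0) (g : LinesNotThroughZero K A → M) :
    (∏ᶠ y : {y : IncidentPairs K A // incPoint K A y = ptOf K e v hv}, g (incLine K A y.1)) =
      ∏ φ : Plane3, if φ.dot v = 1 then lnFun e g φ else 1 := by
  rw [prod_ite_eq_prod_subtype, ← finprod_eq_prod_of_fintype]
  refine (finprod_eq_of_bijective (fun φ : {φ : Plane3 // φ.dot v = 1} =>
    (⟨⟨(ptOf K e v hv, lnOf K e φ.1 (Plane3.left_ne_zero φ.2)),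
      (ptOf_mem_lnOf e (hv := hv) (hφ := Plane3.left_ne_zero φ.2)).2 φ.2⟩, rfl⟩ :
      {y : IncidentPairs K A // incPoint K A y = ptOf K e v hv})) ⟨?_, ?_⟩ ?_).symm
  · intro φ ψ h
    exact Subtype.ext ((lnOf_inj e (hφ := Plane3.left_ne_zero φ.2)
      (hψ := Plane3.left_ne_zero ψ.2)).1 (congrArg (fun y :
        {y : IncidentPairs K A // incPoint K A y = ptOf K e v hv} => incLine K A y.1) h))
  · rintro ⟨⟨⟨T, l⟩, hT⟩, rfl : T = _⟩
    obtain ⟨φ, hφ, rfl⟩ := lnOf_surjective e l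
    exact ⟨⟨φ, (ptOf_mem_lnOf e (hv := hv) (hφ := hφ)).1 hT⟩, rfl⟩
  · intro φ
    exact lnFun_of_ne e g (Plane3.left_ne_zero φ.2)

theorem finprod_lineThrough {v : Plane3} (hv : v ≠ 0) (f : NonzeroPts K A → M) :
    (∏ᶠ y : {y : NonzeroPts K A // lineThrough K A y = lineThrough K A (ptOf K e v hv)}, f y.1) =
      ptFun e f v * ptFun e f (-v) := by
  have hne : ∀ v : Plane3, v ≠ 0 → v ≠ -v := by decide
  have h0 : ∀ w : {w : Plane3 // w = v ∨ w = -v}, w.1 ≠ 0 := by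
    rintro ⟨w, rfl | rfl⟩
    · exact hv
    · exact neg_ne_zero.2 hv
  have : ptFun e f v * ptFun e f (-v) = ∏ w : {w : Plane3 // w = v ∨ w = -v}, ptFun e f w := by
    rw [← prod_ite_eq_prod_subtype, ← Finset.prod_filter, Finset.filter_or, Finset.filter_eq',
      Finset.filter_eq', if_pos (Finset.mem_univ _), if_pos (Finset.mem_univ _),
      Finset.prod_union (by simpa using hne v hv), Finset.prod_singleton, Finset.prod_singleton]
  rw [this, ← finprod_eq_prod_of_fintype]
  refine (finprod_eq_of_bijective (fun w : {w : Plane3 // w = v ∨ w = -v} =>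
    (⟨ptOf K e w.1 (h0 w), (lineThrough_ptOf_eq_iff e).2 w.2⟩ :
      {y : NonzeroPts K A // lineThrough K A y = lineThrough K A (ptOf K e v hv)}))
      ⟨?_, ?_⟩ ?_).symm
  · intro v w h
    exact Subtype.ext (e.symm.injective (congrArg (fun y => y.1.1) h))
  · rintro ⟨T, hT⟩
    obtain ⟨w, hw, rfl⟩ := ptOf_surjective K e T
    exact ⟨⟨w, (lineThrough_ptOf_eq_iff e).1 hT⟩, rfl⟩
  · intro v
    exact ptFun_of_ne e f (h0 v)

theorem prod_plane3_eq_prod_subtype {f : Plane3 → M} (h : f 0 = 1) :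
    ∏ v, f v = ∏ v : {v : Plane3 // v ≠ 0}, f v := by
  rw [← prod_ite_eq_prod_subtype]
  refine Finset.prod_congr rfl fun v _ => ?_
  split_ifs with hv
  · rfl
  · rw [not_not.1 hv, h]

theorem finprod_pts (f : NonzeroPts K A → M) :
    (∏ᶠ y : {y : NonzeroPts K A // toPt (K := K) (NonzeroPts K A) y = GalPt.pt}, f y.1) =
      ∏ v, ptFun e f v := by
  rw [prod_plane3_eq_prod_subtype (ptFun_zero e f), ← finprod_eq_prod_of_fintype]
  refine (finprod_eq_of_bijective (fun v : {v : Plane3 // v ≠ 0} =>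
    (⟨ptOf K e v.1 v.2, rfl⟩ : {y : NonzeroPts K A // toPt (K := K) (NonzeroPts K A) y = GalPt.pt}))
      ⟨?_, ?_⟩ ?_).symm
  · intro v w h
    exact Subtype.ext (e.symm.injective (congrArg (fun y => y.1.1) h))
  · rintro ⟨T, hT⟩
    obtain ⟨w, hw, rfl⟩ := ptOf_surjective K e T
    exact ⟨⟨w, hw⟩, rfl⟩
  · intro v
    exact ptFun_of_ne e f v.2

theorem finprod_lns (g : LinesNotThroughZero K A → M) :
    (∏ᶠ y : {y : LinesNotThroughZero K A //
      toPt (K := K) (LinesNotThroughZero K A) y = GalPt.pt}, g y.1) = ∏ φ, lnFun e g φ := by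
  rw [prod_plane3_eq_prod_subtype (lnFun_zero e g), ← finprod_eq_prod_of_fintype]
  refine (finprod_eq_of_bijective (fun φ : {φ : Plane3 // φ ≠ 0} =>
    (⟨lnOf K e φ.1 φ.2, rfl⟩ : {y : LinesNotThroughZero K A //
      toPt (K := K) (LinesNotThroughZero K A) y = GalPt.pt}))
      ⟨?_, ?_⟩ ?_).symm
  · intro φ ψ h
    exact Subtype.ext ((lnOf_inj e (hφ := φ.2) (hψ := ψ.2)).1 (congrArg Subtype.val h))
  · rintro ⟨T, hT⟩
    obtain ⟨w, hw, rfl⟩ := lnOf_surjective e T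
    exact ⟨⟨w, hw⟩, rfl⟩
  · intro v
    exact lnFun_of_ne e g v.2

/-- One point on each line through `0`. -/
def Plane3.directions : Finset Plane3 := {(1, 0), (0, 1), (1, 1), (1, 2)}

theorem finprod_linesThroughZero (r : LinesThroughZero K A → M) :
    (∏ᶠ y : {y : LinesThroughZero K A //
      toPt (K := K) (LinesThroughZero K A) y = GalPt.pt}, r y.1) =
      ∏ v ∈ Plane3.directions, ptFun e (fun T => r (lineThrough K A T)) v := by
  have h0 : ∀ v ∈ Plane3.directions, v ≠ 0 := by decide
  have hinj : ∀ v ∈ Plane3.directions, ∀ w ∈ Plane3.directions, v = w ∨ v = -w → v = w := by decide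
  have hsurj : ∀ v : Plane3, v ≠ 0 → ∃ w ∈ Plane3.directions, w = v ∨ w = -v := by decide
  rw [← Finset.prod_coe_sort, ← finprod_eq_prod_of_fintype]
  refine (finprod_eq_of_bijective (fun v : Plane3.directions =>
    (⟨lineThrough K A (ptOf K e v.1 (h0 v.1 v.2)), rfl⟩ :
      {y : LinesThroughZero K A // toPt (K := K) (LinesThroughZero K A) y = GalPt.pt}))
      ⟨?_, ?_⟩ ?_).symm
  · intro v w h
    exact Subtype.ext (hinj v v.2 w w.2 ((lineThrough_ptOf_eq_iff e
      (hv := h0 v.1 v.2) (hw := h0 w.1 w.2)).1 (congrArg Subtype.val h)))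
  · rintro ⟨l, hl⟩
    obtain ⟨T, rfl⟩ := lineThrough_surjective l
    obtain ⟨v, hv, rfl⟩ := ptOf_surjective K e T
    obtain ⟨w, hw, h⟩ := hsurj v hv
    exact ⟨⟨w, hw⟩, Subtype.ext ((lineThrough_ptOf_eq_iff e).2 h)⟩
  · intro v
    exact ptFun_of_ne e _ (h0 v.1 v.2)

end Norms

/-! ### Incidence identities and linear algebra over 𝔽₃. -/

section Model

theorem forall_zmod_three {p : ZMod 3 → Prop} : (∀ a, p a) ↔ p 0 ∧ p 1 ∧ p 2 :=
  ⟨fun h => ⟨h _, h _, h _⟩, fun ⟨h0, h1, h2⟩ a => by fin_cases a <;> assumption⟩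

theorem prod_zmod_three {M : Type*} [CommMonoid M] (f : ZMod 3 → M) :
    ∏ a, f a = f 0 * f 1 * f 2 := Fin.prod_univ_three f

theorem sum_zmod_three {M : Type*} [AddCommMonoid M] (f : ZMod 3 → M) :
    ∑ a, f a = f 0 + f 1 + f 2 := Fin.sum_univ_three f

variable {M : Type*} [CommRing M]

/-- The product over the lines through a point of the products over the lines. -/
theorem prod_prod_dot (f : Plane3 → M) : ∀ v : Plane3, v ≠ 0 →
    f v ^ 3 * ∏ w ∈ Plane3.directions, f w * f (-w) = f v * f (-v) *
      ∏ φ : Plane3, if φ.dot v = 1 then ∏ w : Plane3, if φ.dot w = 1 then f w else 1 else 1 := by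
  -- The three lines through `v` avoiding 0 contain `v` three times and each point other than 0, ±v
  -- exactly once.
  have h1 : (-1 : ZMod 3) = 2 := by decide
  have h2 : (-2 : ZMod 3) = 1 := by decide
  simp only [Prod.forall, forall_zmod_three, Fintype.prod_prod_type, prod_zmod_three,
    Plane3.directions]
  simp +decide [Finset.prod_insert, Prod.neg_mk, h1, h2]
  refine ⟨⟨?_, ?_⟩, ⟨?_, ?_, ?_⟩, ?_, ?_, ?_⟩ <;> ring

theorem prod_all_dot (f : Plane3 → M) (h : f 0 = 1) :
    ∏ v, f v ^ 3 =
      ∏ φ : Plane3, if φ = 0 then 1 else ∏ w : Plane3, if φ.dot w = 1 then f w else 1 := by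
  simp only [Fintype.prod_prod_type, prod_zmod_three]
  -- Each nonzero point lies on exactly three lines avoiding 0.
  rw [show (0 : Plane3) = (0, 0) from rfl] at h
  simp +decide [h]
  ring

/-- Three elements of 𝔽₃ with sum 0 are all equal or all distinct, so their product is the common
value in the first case and 0 in the second. This turns the case distinction defining `o` into a
polynomial formula. -/
theorem zmod_three_eq_mul_mul : ∀ a b c x : ZMod 3, a + b + c = 0 →
    ((a = 0 → b = 0 → c = 0 → x = 0) ∧ (a = 1 → b = 1 → c = 1 → x = 1) ∧
      (a = 2 → b = 2 → c = 2 → x = 2)) → ((b = a → ¬ c = a) → x = 0) → x = a * b * c := by decide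

/-- A function on the lines of `𝔽₃²` not through `0` whose sums over the lines through a point `v`
are `U - υ v`, and whose total sum is `0`, is obtained by summing over lines a function with even
part `-υ` and odd part `o`, where `o` is supported on a pair of opposite points. -/
theorem sum_dot_eq (τ υ o : Plane3 → ZMod 3) (hυ : ∀ v, υ (-v) = υ v)
    (h1 : ∀ v, v ≠ 0 → υ v + (∑ φ : Plane3, if φ.dot v = 1 then τ φ else 0) =
      ∑ w ∈ Plane3.directions, υ w)
    (h2 : ∑ φ, τ φ = 0) (h0 : τ 0 = 0)
    (ho : ∀ v, v ≠ 0 → ∀ a, (∀ φ : Plane3, φ.dot v = 1 → τ (-φ) - τ φ = a) → o v = a)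
    (ho' : ∀ v, v ≠ 0 → (¬ ∃ a, ∀ φ : Plane3, φ.dot v = 1 → τ (-φ) - τ φ = a) → o v = 0) :
    ∀ φ : Plane3, φ ≠ 0 → (∑ v : Plane3, if φ.dot v = 1 then -υ v + o v else 0) = τ φ := by
  have n1 : (-1 : ZMod 3) = 2 := by decide
  have n2 : (-2 : ZMod 3) = 1 := by decide
  obtain ⟨U, hU⟩ : ∃ U, U = ∑ w ∈ Plane3.directions, υ w := ⟨_, rfl⟩
  rw [← hU] at h1
  rw [show (0 : Plane3) = (0, 0) from rfl] at h0
  simp only [Prod.forall, forall_zmod_three, Fintype.sum_prod_type, sum_zmod_three,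
    Plane3.directions] at *
  simp +decide [Finset.sum_insert, Prod.neg_mk, n1, n2, h0] at *
  clear n1 n2
  obtain ⟨⟨e01, e02⟩, ⟨e10, e11, e12⟩, e20, e21, e22⟩ := h1
  obtain ⟨⟨u2, -⟩, ⟨u1, u3, u4⟩, -⟩ := hυ
  obtain ⟨⟨a01, a02⟩, ⟨a10, a11, a12⟩, a20, a21, a22⟩ := ho
  obtain ⟨⟨b01, b02⟩, ⟨b10, b11, b12⟩, b20, b21, b22⟩ := ho'
  -- As `υ` is even, comparing `h1` at `v` and `-v` shows that the differences τ(-φ) - τ(φ) on the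
  -- three lines through `v` sum to 0.
  replace a01 := zmod_three_eq_mul_mul _ _ _ _ (by linear_combination e02 - e01 - u2) a01 b01
  replace a02 := zmod_three_eq_mul_mul _ _ _ _ (by linear_combination e01 - e02 + u2) a02 b02
  replace a10 := zmod_three_eq_mul_mul _ _ _ _ (by linear_combination e20 - e10 - u1) a10 b10
  replace a20 := zmod_three_eq_mul_mul _ _ _ _ (by linear_combination e10 - e20 + u1) a20 b20
  replace a11 := zmod_three_eq_mul_mul _ _ _ _ (by linear_combination e22 - e11 - u3) a11 b11
  replace a22 := zmod_three_eq_mul_mul _ _ _ _ (by linear_combination e11 - e22 + u3) a22 b22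
  replace a12 := zmod_three_eq_mul_mul _ _ _ _ (by linear_combination e21 - e12 - u4) a12 b12
  replace a21 := zmod_three_eq_mul_mul _ _ _ _ (by linear_combination e12 - e21 + u4) a21 b21
  clear b01 b02 b10 b11 b12 b20 b21 b22
  generalize τ (0, 1) = t2, τ (1, 0) = t1, τ (1, 1) = t3, τ (1, 2) = t4, τ (0, 2) = t2',
    τ (2, 0) = t1', τ (2, 2) = t3', τ (2, 1) = t4', υ (0, 1) = v2, υ (1, 0) = v1,
    υ (1, 1) = v3, υ (1, 2) = v4, υ (0, 2) = v2', υ (2, 0) = v1', υ (2, 2) = v3',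
    υ (2, 1) = v4', o (0, 1) = o2, o (1, 0) = o1, o (1, 1) = o3, o (1, 2) = o4, o (0, 2) = o2',
    o (2, 0) = o1', o (2, 2) = o3', o (2, 1) = o4' at *
  subst a01 a02 a10 a11 a12 a20 a21 a22 u1 u2 u3 u4
  -- The odd part of `τ` is determined by the two differences `d1`, `d2`; the even values of `υ` and
  -- one more value of `τ` are then eliminated linearly.
  obtain ⟨d1, h⟩ : ∃ d, d = t1' - t1 := ⟨_, rfl⟩
  obtain rfl : t1' = t1 + d1 := by rw [h]; ring
  clear h
  obtain ⟨d2, h⟩ : ∃ d, d = t2' - t2 := ⟨_, rfl⟩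
  obtain rfl : t2' = t2 + d2 := by rw [h]; ring
  clear h
  have h3 : (3 : ZMod 3) = 0 := by decide
  -- The remaining identities hold as polynomials modulo 3 and x³ = x for `d1`, `d2`.
  have hcube : ∀ x : ZMod 3, x ^ 3 = x := by decide
  have c1 := hcube d1
  have c2 := hcube d2
  clear hcube
  obtain rfl : t3' = t3 + d1 + d2 := by linear_combination e11 - e22
  obtain rfl : t4' = t4 + d1 - d2 := by linear_combination e12 - e21
  obtain rfl : v1' = U - (t1 + t3 + t4) := by linear_combination e10
  obtain rfl : v2' = U - (t2 + t3 + t4 + d1 - d2) := by linear_combination e01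
  obtain rfl : v3' = U - (t2 + t1 + t3 + d1 + d2) := by linear_combination e11
  obtain rfl : v4' = U - (t2 + t4 + t1 + d1) := by linear_combination e21
  obtain rfl : t4 = d2 - t1 - t2 - t3 := by
    linear_combination 2 * h2 - (t1 + t2 + t3 + t4 + 2 * d1 + d2) * h3
  clear e10 e01 e11 e20 e21 e02 e12 e22 h2 hU h0 h3
  refine ⟨⟨?_, ?_⟩, ⟨?_, ?_, ?_⟩, ?_, ?_, ?_⟩
  all_goals grind

theorem Plane3.exists_dot_eq_one : ∀ v : Plane3, v ≠ 0 → ∃ φ : Plane3, φ.dot v = 1 := by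
  unfold Plane3.dot; decide

/-- Multiplicative form of `sum_dot_eq`, for functions with values in the cube roots of unity. -/
theorem prod_dot_eq {k : Type*} [Field k] [IsAlgClosed k] (hk : (3 : k) ≠ 0) (t u z : Plane3 → k)
    (ht : ∀ φ, t φ ^ 3 = 1) (hu : ∀ v, u v ^ 3 = 1) (hneg : ∀ v, u (-v) = u v)
    (h1 : ∀ v, v ≠ 0 → u v * (∏ φ : Plane3, if φ.dot v = 1 then t φ else 1) =
      ∏ w ∈ Plane3.directions, u w)
    (h2 : ∏ φ, t φ = 1) (h0 : t 0 = 1)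
    (hz : ∀ v, v ≠ 0 → ∀ a, (∀ φ : Plane3, φ.dot v = 1 → t (-φ) / t φ = a) → z v = a)
    (hz' : ∀ v, v ≠ 0 → (¬ ∃ a, ∀ φ : Plane3, φ.dot v = 1 → t (-φ) / t φ = a) → z v = 1)
    (φ : Plane3) (hφ : φ ≠ 0) :
    (∏ v : Plane3, if φ.dot v = 1 then (u v)⁻¹ * z v else 1) = t φ := by
  -- A primitive cube root of unity identifies μ₃ with 𝔽₃ through the injective character `χ`, which
  -- carries everything to `sum_dot_eq`.
  have : NeZero ((3 : ℕ) : k) := ⟨by exact_mod_cast hk⟩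
  obtain ⟨ω, hω⟩ := HasEnoughRootsOfUnity.exists_primitiveRoot k 3
  set χ : AddChar (ZMod 3) k := AddChar.zmodChar 3 hω.pow_eq_one with hχ
  have hinj : Function.Injective χ := fun a b h => by
    rw [hχ, AddChar.zmodChar_apply, AddChar.zmodChar_apply] at h
    exact ZMod.val_injective 3 (hω.pow_inj (ZMod.val_lt a) (ZMod.val_lt b) h)
  have hsurj : ∀ x : k, x ^ 3 = 1 → ∃ a, x = χ a := fun x hx => by
    obtain ⟨i, hi, h⟩ := hω.eq_pow_of_pow_eq_one hx
    exact ⟨i, by rw [hχ, AddChar.zmodChar_apply, ZMod.val_cast_of_lt hi, h]⟩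
  have hex : ∀ v, ∃ a, v ≠ 0 → z v = χ a := fun v => by
    by_cases hv : v = 0
    · exact ⟨0, fun h => absurd hv h⟩
    by_cases h : ∃ a, ∀ φ : Plane3, φ.dot v = 1 → t (-φ) / t φ = a
    · obtain ⟨a, ha⟩ := h
      obtain ⟨ψ, hψ⟩ := Plane3.exists_dot_eq_one v hv
      obtain ⟨b, hb⟩ := hsurj a (by rw [← ha ψ hψ, div_pow, ht, ht, div_one])
      exact ⟨b, fun _ => by rw [hz v hv a ha, hb]⟩
    · exact ⟨0, fun _ => by rw [hz' v hv h, AddChar.map_zero_eq_one]⟩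
  choose τ hτ using fun φ => hsurj (t φ) (ht φ)
  choose υ hυ using fun v => hsurj (u v) (hu v)
  choose o ho using hex
  have hdiv : ∀ φ, t (-φ) / t φ = χ (τ (-φ) - τ φ) := fun φ => by
    rw [AddChar.map_sub_eq_div, ← hτ, ← hτ]
  have hite : ∀ (p : Prop) [Decidable p] (a : ZMod 3),
      (if p then χ a else 1) = χ (if p then a else 0) := fun p _ a => by
    split_ifs
    · rfl
    · rw [AddChar.map_zero_eq_one]
  have hsum : ∀ (s : Finset Plane3) (f : Plane3 → ZMod 3), χ (∑ i ∈ s, f i) = ∏ i ∈ s, χ (f i) :=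
    fun s f => by
      induction s using Finset.cons_induction with
      | empty => simp
      | cons a s ha ih => rw [Finset.sum_cons, Finset.prod_cons, AddChar.map_add_eq_mul, ih]
  have key := sum_dot_eq τ υ o (fun v => hinj (by rw [← hυ, ← hυ, hneg])) (fun v hv => hinj ?_)
    (hinj ?_) (hinj ?_) (fun v hv a ha => hinj ?_) (fun v hv hn => hinj ?_) φ hφ
  · rw [hτ φ, ← key, hsum]
    refine Finset.prod_congr rfl fun v _ => ?_
    rw [← hite]
    split_ifs with hv
    · rw [AddChar.map_add_eq_mul, AddChar.map_neg_eq_inv, ← hυ, ← ho v (Plane3.right_ne_zero hv)]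
    · rfl
  · have := h1 v hv
    simp only [hτ, hυ, hite, ← hsum, ← AddChar.map_add_eq_mul] at this
    exact this
  · simp only [hτ, ← hsum] at h2
    rw [h2, AddChar.map_zero_eq_one]
  · rw [← hτ, h0, AddChar.map_zero_eq_one]
  · rw [← ho v hv]
    exact hz v hv _ fun φ hφ => by rw [hdiv, ha φ hφ]
  · rw [← ho v hv, AddChar.map_zero_eq_one]
    refine hz' v hv fun ⟨a, ha⟩ => hn ?_
    obtain ⟨ψ, hψ⟩ := Plane3.exists_dot_eq_one v hv
    refine ⟨τ (-ψ) - τ ψ, fun θ hθ => hinj ?_⟩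
    rw [← hdiv, ← hdiv, ha θ hθ, ha ψ hψ]

end Model

/-! ### Lines as Galois sets, and the canonical common value. -/

section GaloisSets

variable {K : Type u} [Field K] {A : Type*} [AddCommGroup A] [DistribMulAction (GalK K) A]

/-- The line `-l`. -/
def negLine (l : LinesNotThroughZero K A) : LinesNotThroughZero K A :=
  ⟨-l.1, by
    obtain ⟨P, Q, hQ, hl⟩ := l.2.1
    refine ⟨⟨-P, -Q, neg_ne_zero.2 hQ, ?_⟩, fun h => l.2.2 (by simpa using h)⟩
    ext x
    rw [Set.mem_neg, hl]
    refine exists_congr fun k => ?_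
    rw [smul_neg, ← neg_add, neg_eq_iff_eq_neg]⟩

theorem mem_negLine {l : LinesNotThroughZero K A} {a : A} : a ∈ (negLine l).1 ↔ -a ∈ l.1 := Iff.rfl

theorem smul_negLine (σ : GalK K) (l : LinesNotThroughZero K A) :
    negLine (σ • l) = σ • negLine l := by
  refine Subtype.ext (Set.ext fun a => ?_)
  rw [mem_negLine]
  change -a ∈ σ • l.1 ↔ a ∈ σ • (negLine l).1
  rw [Set.mem_smul_set_iff_inv_smul_mem, Set.mem_smul_set_iff_inv_smul_mem, mem_negLine, smul_neg]

theorem negLine_lnOf (e : A ≃+ Plane3) {φ : Plane3} (hφ : φ ≠ 0) :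
    negLine (lnOf K e φ hφ) = lnOf K e (-φ) (neg_ne_zero.2 hφ) := by
  refine Subtype.ext (Set.ext fun a => ?_)
  rw [mem_negLine]
  change φ.dot (e (-a)) = 1 ↔ (-φ).dot (e a) = 1
  simp [Plane3.dot]

theorem mem_smul_line {σ : GalK K} {l : LinesNotThroughZero K A} {a : A} :
    a ∈ (σ • l).1 ↔ σ⁻¹ • a ∈ l.1 :=
  Set.mem_smul_set_iff_inv_smul_mem

/-- The common value of a function on the lines through a point, or `1` if there is none. -/
def commonValue (d : LinesNotThroughZero K A → KBar K) (T : NonzeroPts K A) : KBar K :=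
  open Classical in
  if h : ∃ a, ∀ l : LinesNotThroughZero K A, T.1 ∈ l.1 → d l = a then h.choose else 1

theorem commonValue_of_not {d : LinesNotThroughZero K A → KBar K} {T : NonzeroPts K A}
    (h : ¬ ∃ a, ∀ l : LinesNotThroughZero K A, T.1 ∈ l.1 → d l = a) : commonValue d T = 1 :=
  dif_neg h

theorem exists_line (e : A ≃+ Plane3) (T : NonzeroPts K A) :
    ∃ l : LinesNotThroughZero K A, T.1 ∈ l.1 := by
  obtain ⟨v, hv, rfl⟩ := ptOf_surjective K e T
  obtain ⟨φ, hφ⟩ := Plane3.exists_dot_eq_one v hv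
  exact ⟨lnOf K e φ (Plane3.left_ne_zero hφ), (ptOf_mem_lnOf e (hv := hv)).2 hφ⟩

theorem commonValue_eq (e : A ≃+ Plane3) {d : LinesNotThroughZero K A → KBar K}
    {T : NonzeroPts K A} {a : KBar K}
    (h : ∀ l : LinesNotThroughZero K A, T.1 ∈ l.1 → d l = a) : commonValue d T = a := by
  have hex : ∃ a, ∀ l : LinesNotThroughZero K A, T.1 ∈ l.1 → d l = a := ⟨a, h⟩
  obtain ⟨l, hl⟩ := exists_line e T
  rw [commonValue, dif_pos hex, ← hex.choose_spec l hl, h l hl]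

theorem commonValue_pow (e : A ≃+ Plane3) {d : LinesNotThroughZero K A → KBar K} {n : ℕ}
    (hd : ∀ l, d l ^ n = 1) (T : NonzeroPts K A) : commonValue d T ^ n = 1 := by
  by_cases h : ∃ a, ∀ l : LinesNotThroughZero K A, T.1 ∈ l.1 → d l = a
  · obtain ⟨a, ha⟩ := h
    obtain ⟨l, hl⟩ := exists_line e T
    rw [commonValue_eq e ha, ← ha l hl, hd]
  · rw [commonValue_of_not h, one_pow]

/-- No choice enters the rule, so `σ` carries a common value at `T` to one at `σT`. Applying this to
σ⁻¹ as well matches the default branches, where the value 1 is fixed by `σ`. -/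
theorem commonValue_smul (e : A ≃+ Plane3) {d : LinesNotThroughZero K A → KBar K}
    (hd : ∀ (σ : GalK K) l, d (σ • l) = σ (d l)) (σ : GalK K) (T : NonzeroPts K A) :
    commonValue d (σ • T) = σ (commonValue d T) := by
  have key : ∀ (σ : GalK K) (T : NonzeroPts K A) (a : KBar K),
      (∀ l : LinesNotThroughZero K A, T.1 ∈ l.1 → d l = a) →
      ∀ l : LinesNotThroughZero K A, (σ • T).1 ∈ l.1 → d l = σ a := by
    intro σ T a h l hl
    have := h (σ⁻¹ • l) (by rw [mem_smul_line, inv_inv]; exact hl)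
    rw [← this, ← hd, smul_inv_smul]
  by_cases h : ∃ a, ∀ l : LinesNotThroughZero K A, T.1 ∈ l.1 → d l = a
  · obtain ⟨a, ha⟩ := h
    rw [commonValue_eq e ha, commonValue_eq e (key σ T a ha)]
  · rw [commonValue_of_not h, commonValue_of_not, map_one]
    rintro ⟨a, ha⟩
    refine h ⟨σ⁻¹ a, ?_⟩
    have := key σ⁻¹ (σ • T) a ha
    rwa [inv_smul_smul] at this

/-- A line not through `0` consists of three points with sum `0`. -/
theorem exists_model_triple (e : A ≃+ Plane3) {l : LinesNotThroughZero K A}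
    {S₁ S₂ S₃ : NonzeroPts K A} (h : l.1 = {S₁.1, S₂.1, S₃.1}) :
    S₁.1 + S₂.1 + S₃.1 = 0 ∧ ∃ (φ v₁ v₂ v₃ : Plane3) (hφ : φ ≠ 0) (h₁ : v₁ ≠ 0) (h₂ : v₂ ≠ 0)
      (h₃ : v₃ ≠ 0), l = lnOf K e φ hφ ∧ S₁ = ptOf K e v₁ h₁ ∧ S₂ = ptOf K e v₂ h₂ ∧
      S₃ = ptOf K e v₃ h₃ ∧ (Finset.univ.filter fun v => φ.dot v = 1) = {v₁, v₂, v₃} ∧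
      v₁ ∉ ({v₂, v₃} : Finset Plane3) ∧ v₂ ∉ ({v₃} : Finset Plane3) := by
  obtain ⟨φ, hφ, rfl⟩ := lnOf_surjective e l
  obtain ⟨v₁, h₁, rfl⟩ := ptOf_surjective K e S₁
  obtain ⟨v₂, h₂, rfl⟩ := ptOf_surjective K e S₂
  obtain ⟨v₃, h₃, rfl⟩ := ptOf_surjective K e S₃
  have hcard : ∀ φ : Plane3, φ ≠ 0 → (Finset.univ.filter fun v => φ.dot v = 1).card = 3 ∧
      ∑ v ∈ Finset.univ.filter fun v => φ.dot v = 1, v = 0 := by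
    unfold Plane3.dot; decide
  have hset : (Finset.univ.filter fun v => φ.dot v = 1) = {v₁, v₂, v₃} := by
    ext v
    have := Set.ext_iff.1 h (e.symm v)
    change φ.dot (e (e.symm v)) = 1 ↔ e.symm v ∈ ({e.symm v₁, e.symm v₂, e.symm v₃} : Set A) at this
    simpa using this
  obtain ⟨hc, hs⟩ := hcard φ hφ
  rw [hset] at hc hs
  have h12 : v₁ ∉ ({v₂, v₃} : Finset Plane3) := fun hmem => by
    rw [Finset.insert_eq_of_mem hmem] at hc
    exact absurd (Finset.card_le_two (a := v₂) (b := v₃)) (by omega)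
  have h23 : v₂ ∉ ({v₃} : Finset Plane3) := fun hmem => by
    rw [Finset.insert_eq_of_mem hmem] at hc
    exact absurd (Finset.card_le_two (a := v₁) (b := v₃)) (by omega)
  refine ⟨?_, φ, v₁, v₂, v₃, hφ, h₁, h₂, h₃, rfl, rfl, rfl, rfl, hset, h12, h23⟩
  rw [Finset.sum_insert h12, Finset.sum_insert h23, Finset.sum_singleton] at hs
  change e.symm v₁ + e.symm v₂ + e.symm v₃ = 0
  rw [← map_add, ← map_add, add_assoc, hs, map_zero]

theorem finprod_incLine_eq {M : Type*} [CommMonoid M] (e : A ≃+ Plane3)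
    {l : LinesNotThroughZero K A} {S₁ S₂ S₃ : NonzeroPts K A} (h : l.1 = {S₁.1, S₂.1, S₃.1})
    (f : NonzeroPts K A → M) :
    (∏ᶠ y : {y : IncidentPairs K A // incLine K A y = l}, f (incPoint K A y.1)) =
      f S₁ * f S₂ * f S₃ := by
  obtain ⟨-, φ, v₁, v₂, v₃, hφ, h₁, h₂, h₃, rfl, rfl, rfl, rfl, hset, h12, h23⟩ :=
    exists_model_triple e h
  rw [finprod_incLine, ← Finset.prod_filter, hset, Finset.prod_insert h12,
    Finset.prod_insert h23, Finset.prod_singleton, ptFun_of_ne, ptFun_of_ne, ptFun_of_ne, mul_assoc]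

theorem exists_triple (e : A ≃+ Plane3) (l : LinesNotThroughZero K A) :
    ∃ S₁ S₂ S₃ : NonzeroPts K A, l.1 = {S₁.1, S₂.1, S₃.1} := by
  obtain ⟨φ, hφ, rfl⟩ := lnOf_surjective e l
  have hcard : ∀ φ : Plane3, φ ≠ 0 → (Finset.univ.filter fun v => φ.dot v = 1).card = 3 := by
    unfold Plane3.dot; decide
  obtain ⟨v₁, v₂, v₃, -, -, -, h⟩ := Finset.card_eq_three.1 (hcard φ hφ)
  replace h : ∀ v, φ.dot v = 1 ↔ v = v₁ ∨ v = v₂ ∨ v = v₃ := fun v => by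
    simpa using Finset.ext_iff.1 h v
  have h₁ := Plane3.right_ne_zero ((h v₁).2 (by simp))
  have h₂ := Plane3.right_ne_zero ((h v₂).2 (by simp))
  have h₃ := Plane3.right_ne_zero ((h v₃).2 (by simp))
  refine ⟨ptOf K e v₁ h₁, ptOf K e v₂ h₂, ptOf K e v₃ h₃, Set.ext fun a => ?_⟩
  change φ.dot (e a) = 1 ↔ a ∈ ({e.symm v₁, e.symm v₂, e.symm v₃} : Set A)
  simp [h, AddEquiv.eq_symm_apply]

end GaloisSets

/-! ### The conditions on r and s in coordinates. -/

section Coordinates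

variable {k : Type*} [Field k]

/-- The conditions on cube roots `r`, `s` of norms of `a`, in coordinates. -/
structure CoordCubeRoots (a r s : Plane3 → k) : Prop where
  pair : ∀ v, v ≠ 0 → a v * a (-v) = r v ^ 3
  line : ∀ φ : Plane3, φ ≠ 0 → (∏ v : Plane3, if φ.dot v = 1 then a v else 1) = s φ ^ 3
  point : ∀ v, v ≠ 0 → a v * ∏ w ∈ Plane3.directions, r w =
    r v * ∏ φ : Plane3, if φ.dot v = 1 then s φ else 1
  total : ∏ v, a v = ∏ φ, s φ

section NormConditions

variable {K : Type u} [Field K] {A : Type*} [AddCommGroup A] [DistribMulAction (GalK K) A]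

theorem norm_lineThrough_eq_pow_iff (e : A ≃+ Plane3) (α : EtaleAlg K (NonzeroPts K A))
    (r : EtaleAlg K (LinesThroughZero K A)) :
    EtaleAlg.norm (lineThrough K A) α = r ^ 3 ↔ ∀ v, v ≠ 0 →
      ptFun e α.1 v * ptFun e α.1 (-v) = ptFun e (fun T => r.1 (lineThrough K A T)) v ^ 3 := by
  rw [Subtype.ext_iff, funext_iff]
  constructor
  · intro h v hv
    rw [← finprod_lineThrough e hv, ptFun_of_ne e _ hv]
    exact h _
  · intro h ℓ
    obtain ⟨T, rfl⟩ := lineThrough_surjective ℓ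
    obtain ⟨v, hv, rfl⟩ := ptOf_surjective K e T
    have := h v hv
    rw [← finprod_lineThrough e hv, ptFun_of_ne e _ hv] at this
    exact this

theorem norm_incLine_eq_pow_iff (e : A ≃+ Plane3) (α : EtaleAlg K (NonzeroPts K A))
    (s : EtaleAlg K (LinesNotThroughZero K A)) :
    EtaleAlg.norm (incLine K A) (EtaleAlg.incl (incPoint K A) α) = s ^ 3 ↔
      ∀ φ : Plane3, φ ≠ 0 → (∏ v : Plane3, if φ.dot v = 1 then ptFun e α.1 v else 1) =
        lnFun e s.1 φ ^ 3 := by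
  rw [Subtype.ext_iff, funext_iff]
  constructor
  · intro h φ hφ
    rw [← finprod_incLine e hφ, lnFun_of_ne e _ hφ]
    exact h _
  · intro h l
    obtain ⟨φ, hφ, rfl⟩ := lnOf_surjective e l
    have := h φ hφ
    rw [← finprod_incLine e hφ, lnFun_of_ne e _ hφ] at this
    exact this

theorem mul_norm_eq_iff (e : A ≃+ Plane3) (α : EtaleAlg K (NonzeroPts K A))
    (r : EtaleAlg K (LinesThroughZero K A)) (s : EtaleAlg K (LinesNotThroughZero K A)) :
    α * EtaleAlg.incl (toPt _) (EtaleAlg.norm (toPt _) r) =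
      EtaleAlg.incl (lineThrough K A) r *
        EtaleAlg.norm (incPoint K A) (EtaleAlg.incl (incLine K A) s) ↔
      ∀ v, v ≠ 0 → ptFun e α.1 v *
        ∏ w ∈ Plane3.directions, ptFun e (fun T => r.1 (lineThrough K A T)) w =
        ptFun e (fun T => r.1 (lineThrough K A T)) v *
          ∏ φ : Plane3, if φ.dot v = 1 then lnFun e s.1 φ else 1 := by
  have key : ∀ v (hv : v ≠ 0), (ptFun e α.1 v *
        ∏ w ∈ Plane3.directions, ptFun e (fun T => r.1 (lineThrough K A T)) w =
        ptFun e (fun T => r.1 (lineThrough K A T)) v *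
          ∏ φ : Plane3, if φ.dot v = 1 then lnFun e s.1 φ else 1) ↔
      (α * EtaleAlg.incl (toPt _) (EtaleAlg.norm (toPt _) r)).1 (ptOf K e v hv) =
      (EtaleAlg.incl (lineThrough K A) r *
        EtaleAlg.norm (incPoint K A) (EtaleAlg.incl (incLine K A) s)).1 (ptOf K e v hv) := by
    intro v hv
    rw [← finprod_incPoint e hv, ← finprod_linesThroughZero e, ptFun_of_ne e _ hv,
      ptFun_of_ne e _ hv]
    exact Iff.rfl
  rw [Subtype.ext_iff, funext_iff]
  constructor
  · exact fun h v hv => (key v hv).2 (h _)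
  · intro h T
    obtain ⟨v, hv, rfl⟩ := ptOf_surjective K e T
    exact (key v hv).1 (h v hv)

theorem norm_toPt_eq_iff (e : A ≃+ Plane3) (α : EtaleAlg K (NonzeroPts K A))
    (s : EtaleAlg K (LinesNotThroughZero K A)) :
    EtaleAlg.norm (toPt _) α = EtaleAlg.norm (toPt _) s ↔
      ∏ v, ptFun e α.1 v = ∏ φ, lnFun e s.1 φ := by
  rw [Subtype.ext_iff, funext_iff, ← finprod_pts, ← finprod_lns]
  exact ⟨fun h => h GalPt.pt, fun h x => by cases x; exact h⟩

end NormConditions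

theorem cubeRootConditions_iff {K : Type u} [Field K] {E : WeierstrassCurve K}
    (e : Tors E 3 ≃+ Plane3) (α : AlgL E 3) (r : AlgLPlus E 3) (s : AlgLPrime E 3) :
    CubeRootConditions α r s ↔ CoordCubeRoots (ptFun e α.1)
      (ptFun e fun T => r.1 (lineThrough K (Tors E 3) T)) (lnFun e s.1) := by
  constructor
  · rintro ⟨h1, h2, h3, h4⟩
    exact ⟨(norm_lineThrough_eq_pow_iff e α r).1 h1, (norm_incLine_eq_pow_iff e α s).1 h2,
      (mul_norm_eq_iff e α r s).1 h3, (norm_toPt_eq_iff e α s).1 h4⟩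
  · rintro ⟨h1, h2, h3, h4⟩
    exact ⟨(norm_lineThrough_eq_pow_iff e α r).2 h1, (norm_incLine_eq_pow_iff e α s).2 h2,
      (mul_norm_eq_iff e α r s).2 h3, (norm_toPt_eq_iff e α s).2 h4⟩

theorem coordCubeRoots_of_cube {f : Plane3 → k} (h : f 0 = 1) :
    CoordCubeRoots (fun v => f v ^ 3) (fun v => f v * f (-v))
      (fun φ => if φ = 0 then 1 else ∏ w : Plane3, if φ.dot w = 1 then f w else 1) where
  pair v hv := (mul_pow _ _ 3).symm
  line φ hφ := by
    rw [if_neg hφ, ← Finset.prod_pow]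
    refine Finset.prod_congr rfl fun v _ => ?_
    split_ifs <;> simp
  point v hv := by
    rw [prod_prod_dot f v hv]
    congr 1
    refine Finset.prod_congr rfl fun φ _ => ?_
    by_cases hφ : φ.dot v = 1
    · rw [if_pos hφ, if_pos hφ, if_neg (Plane3.left_ne_zero hφ)]
    · rw [if_neg hφ, if_neg hφ]
  total := prod_all_dot f h

/-- Two pairs of cube roots differ by functions to which `prod_dot_eq` applies. -/
theorem CoordCubeRoots.prod_eq [IsAlgClosed k] (hk : (3 : k) ≠ 0) {a r s r₀ s₀ z : Plane3 → k}
    (h : CoordCubeRoots a r s) (h₀ : CoordCubeRoots a r₀ s₀) (ha : ∀ v, a v ≠ 0)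
    (hr : ∀ v, r (-v) = r v) (hr₀ : ∀ v, r₀ (-v) = r₀ v)
    (hr0 : r 0 = 1) (hs0 : s 0 = 1) (hr₀0 : r₀ 0 = 1) (hs₀0 : s₀ 0 = 1)
    (hz : ∀ v, v ≠ 0 → ∀ x, (∀ φ : Plane3, φ.dot v = 1 →
      (s (-φ) / s₀ (-φ)) / (s φ / s₀ φ) = x) → z v = x)
    (hz' : ∀ v, v ≠ 0 → (¬ ∃ x, ∀ φ : Plane3, φ.dot v = 1 →
      (s (-φ) / s₀ (-φ)) / (s φ / s₀ φ) = x) → z v = 1) (φ : Plane3) (hφ : φ ≠ 0) :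
    (∏ v : Plane3, if φ.dot v = 1 then (r v / r₀ v)⁻¹ * z v else 1) = s φ / s₀ φ := by
  have key : ∀ {r s : Plane3 → k}, CoordCubeRoots a r s → r 0 = 1 → s 0 = 1 →
      (∀ v, r v ≠ 0) ∧ ∀ φ, s φ ≠ 0 := by
    intro r s h hr0 hs0
    refine ⟨fun v => ?_, fun φ => ?_⟩
    · by_cases hv : v = 0
      · rw [hv, hr0]; exact one_ne_zero
      · refine fun h0 => mul_ne_zero (ha v) (ha (-v)) ?_
        rw [h.pair v hv, h0, zero_pow three_ne_zero]
    · by_cases hφ : φ = 0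
      · rw [hφ, hs0]; exact one_ne_zero
      · intro h0
        have h1 : (∏ v : Plane3, if φ.dot v = 1 then a v else 1) ≠ 0 :=
          Finset.prod_ne_zero_iff.2 fun v _ => by
            split_ifs
            exacts [ha v, one_ne_zero]
        rw [h.line φ hφ, h0, zero_pow three_ne_zero] at h1
        exact h1 rfl
  obtain ⟨nr, ns⟩ := key h hr0 hs0
  obtain ⟨nr₀, ns₀⟩ := key h₀ hr₀0 hs₀0
  -- Both pairs solve the same equations with the same `a`, which cancels in the quotients.
  refine prod_dot_eq hk (fun φ => s φ / s₀ φ) (fun v => r v / r₀ v) z (fun φ => ?_) (fun v => ?_)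
    (fun v => ?_) (fun v hv => ?_) ?_ ?_ hz hz' φ hφ
  · by_cases hφ : φ = 0
    · rw [hφ, hs0, hs₀0, div_one, one_pow]
    · rw [div_pow, ← h.line φ hφ, ← h₀.line φ hφ, div_self]
      rw [h.line φ hφ]
      exact pow_ne_zero 3 (ns φ)
  · by_cases hv : v = 0
    · rw [hv, hr0, hr₀0, div_one, one_pow]
    · rw [div_pow, ← h.pair v hv, ← h₀.pair v hv, div_self (mul_ne_zero (ha _) (ha _))]
  · rw [hr, hr₀]
  · have e1 := h.point v hv
    have e2 := h₀.point v hv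
    have hdiv : (∏ φ : Plane3, if φ.dot v = 1 then s φ / s₀ φ else 1) =
        (∏ φ : Plane3, if φ.dot v = 1 then s φ else 1) /
          ∏ φ : Plane3, if φ.dot v = 1 then s₀ φ else 1 := by
      rw [← Finset.prod_div_distrib]
      refine Finset.prod_congr rfl fun φ _ => ?_
      split_ifs <;> simp
    have n1 : (∏ φ : Plane3, if φ.dot v = 1 then s₀ φ else 1) ≠ 0 :=
      Finset.prod_ne_zero_iff.2 fun φ _ => by
        split_ifs
        exacts [ns₀ φ, one_ne_zero]
    have n2 : ∏ w ∈ Plane3.directions, r₀ w ≠ 0 := Finset.prod_ne_zero_iff.2 fun v _ => nr₀ v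
    rw [hdiv, Finset.prod_div_distrib, div_mul_div_comm, ← e1, ← e2, mul_div_mul_left _ _ (ha v)]
  · rw [Finset.prod_div_distrib, ← h.total, ← h₀.total, div_self]
    exact Finset.prod_ne_zero_iff.2 fun v _ => ha v
  · rw [hs0, hs₀0, div_one]

end Coordinates

/-! ### Equivariance of the products of γ and of the correcting factor. -/

section GaloisCubeRoots

variable {K : Type u} [Field K] {A : Type*} [AddCommGroup A] [DistribMulAction (GalK K) A]

/-- The function on lines not through `0` whose value is the product over the points. -/
def linesProd (γ : NonzeroPts K A → KBar K) (l : LinesNotThroughZero K A) : KBar K :=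
  ∏ᶠ y : {y : IncidentPairs K A // incLine K A y = l}, γ (incPoint K A y.1)

/-- The function on lines through `0` whose value is the product over the nonzero points. -/
def directionsProd (γ : NonzeroPts K A → KBar K) (l : LinesThroughZero K A) : KBar K :=
  ∏ᶠ y : {y : NonzeroPts K A // lineThrough K A y = l}, γ y.1

theorem lnFun_linesProd (e : A ≃+ Plane3) (γ : NonzeroPts K A → KBar K) :
    lnFun e (linesProd γ) = fun φ =>
      if φ = 0 then 1 else ∏ w : Plane3, if φ.dot w = 1 then ptFun e γ w else 1 := by
  funext φ
  split_ifs with hφ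
  · rw [hφ, lnFun_zero]
  · rw [lnFun_of_ne e _ hφ, linesProd, finprod_incLine]

theorem ptFun_directionsProd (e : A ≃+ Plane3) (γ : NonzeroPts K A → KBar K) :
    (ptFun e fun T => directionsProd γ (lineThrough K A T)) =
      fun v => ptFun e γ v * ptFun e γ (-v) := by
  funext v
  by_cases hv : v = 0
  · rw [hv, neg_zero, ptFun_zero, ptFun_zero, one_mul]
  · rw [ptFun_of_ne e _ hv, directionsProd, finprod_lineThrough]

/-- `w` is, for every `σ`, a homomorphism measuring the failure of `γ` to be equivariant. -/
structure IsTwist (w : GalK K → A → KBar K) (γ : NonzeroPts K A → KBar K) : Prop where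
  map_zero : ∀ σ, w σ 0 = 1
  map_add : ∀ σ S T, w σ (S + T) = w σ S * w σ T
  apply_eq : ∀ σ T, σ (γ T) = w σ (σ • T.1) * γ (σ • T)

/-- The three points of the line sum to 0, so the three factors `w σ` multiply to 1. -/
theorem IsTwist.linesProd_smul {w : GalK K → A → KBar K} {γ : NonzeroPts K A → KBar K}
    (h : IsTwist w γ) (e : A ≃+ Plane3) (σ : GalK K) (l : LinesNotThroughZero K A) :
    linesProd γ (σ • l) = σ (linesProd γ l) := by
  obtain ⟨S₁, S₂, S₃, hl⟩ := exists_triple e l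
  have hσ : (σ • l).1 = {(σ • S₁).1, (σ • S₂).1, (σ • S₃).1} := by
    change σ • l.1 = _
    rw [hl, Set.smul_set_insert, Set.smul_set_insert, Set.smul_set_singleton]
    rfl
  rw [linesProd, linesProd, finprod_incLine_eq e hl, finprod_incLine_eq e hσ, map_mul, map_mul,
    h.apply_eq, h.apply_eq, h.apply_eq]
  have hsum : w σ (σ • S₁.1) * w σ (σ • S₂.1) * w σ (σ • S₃.1) = 1 := by
    rw [← h.map_add, ← h.map_add, ← smul_add, ← smul_add, (exists_model_triple e hl).1, smul_zero,
      h.map_zero]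
  linear_combination -(γ (σ • S₁) * γ (σ • S₂) * γ (σ • S₃)) * hsum

theorem finprod_lineThrough_eq {M : Type*} [CommMonoid M] (e : A ≃+ Plane3) {T T' : NonzeroPts K A}
    (h : T'.1 = -T.1) (f : NonzeroPts K A → M) :
    (∏ᶠ y : {y : NonzeroPts K A // lineThrough K A y = lineThrough K A T}, f y.1) = f T * f T' := by
  obtain ⟨v, hv, rfl⟩ := ptOf_surjective K e T
  have : T' = ptOf K e (-v) (neg_ne_zero.2 hv) := Subtype.ext (h.trans (map_neg e.symm v).symm)
  rw [finprod_lineThrough, ptFun_of_ne e _ hv, ptFun_of_ne e _ (neg_ne_zero.2 hv), this]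

/-- The factors `w σ` at opposite points cancel. -/
theorem IsTwist.directionsProd_smul {w : GalK K → A → KBar K} {γ : NonzeroPts K A → KBar K}
    (h : IsTwist w γ) (e : A ≃+ Plane3) (σ : GalK K) (l : LinesThroughZero K A) :
    directionsProd γ (σ • l) = σ (directionsProd γ l) := by
  obtain ⟨T, rfl⟩ := lineThrough_surjective l
  obtain ⟨T', hT'⟩ : ∃ T' : NonzeroPts K A, T'.1 = -T.1 := ⟨⟨-T.1, neg_ne_zero.2 T.2⟩, rfl⟩
  have hσ : (σ • T').1 = -(σ • T).1 := by
    change σ • T'.1 = -(σ • T.1)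
    rw [hT', smul_neg]
  rw [← map_smul, directionsProd, directionsProd, finprod_lineThrough_eq e hσ,
    finprod_lineThrough_eq e hT', map_mul, h.apply_eq, h.apply_eq]
  have hsum : w σ (σ • T.1) * w σ (σ • T'.1) = 1 := by
    rw [← h.map_add, ← smul_add, hT', add_neg_cancel, smul_zero, h.map_zero]
  linear_combination -(γ (σ • T) * γ (σ • T')) * hsum

/-- The equivariant function by which `γ` is modified to realize given cube roots `r`, `s`. -/
def correction (γ : NonzeroPts K A → KBar K) (r : LinesThroughZero K A → KBar K)
    (s : LinesNotThroughZero K A → KBar K) (T : NonzeroPts K A) : KBar K :=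
  (r (lineThrough K A T) / directionsProd γ (lineThrough K A T))⁻¹ *
    commonValue (fun l => (s (negLine l) / linesProd γ (negLine l)) / (s l / linesProd γ l)) T

theorem IsTwist.correction_smul {w : GalK K → A → KBar K} {γ : NonzeroPts K A → KBar K}
    (h : IsTwist w γ) (e : A ≃+ Plane3) (r : EtaleAlg K (LinesThroughZero K A))
    (s : EtaleAlg K (LinesNotThroughZero K A)) (σ : GalK K) (T : NonzeroPts K A) :
    correction γ r.1 s.1 (σ • T) = σ (correction γ r.1 s.1 T) := by
  rw [correction, correction, map_mul, map_inv₀, map_div₀, map_smul, r.2,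
    h.directionsProd_smul e, commonValue_smul e]
  intro σ l
  rw [smul_negLine, s.2, s.2, h.linesProd_smul e, h.linesProd_smul e, map_div₀, map_div₀, map_div₀]

end GaloisCubeRoots

/-! ### The correcting factor is μ₃-valued with the prescribed line products. -/

section Correction

variable {K : Type u} [Field K] {A : Type*} [AddCommGroup A] [DistribMulAction (GalK K) A]

theorem coordCubeRoots_directionsProd_linesProd (e : A ≃+ Plane3) {a γ : NonzeroPts K A → KBar K}
    (ha : ∀ T, a T = γ T ^ 3) :
    CoordCubeRoots (ptFun e a) (ptFun e fun T => directionsProd γ (lineThrough K A T))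
      (lnFun e (linesProd γ)) := by
  rw [ptFun_directionsProd, lnFun_linesProd]
  convert coordCubeRoots_of_cube (ptFun_zero e γ) using 1
  funext v
  by_cases hv : v = 0
  · rw [hv, ptFun_zero, ptFun_zero, one_pow]
  · rw [ptFun_of_ne e _ hv, ptFun_of_ne e _ hv, ha]

variable {e : A ≃+ Plane3} {a γ : NonzeroPts K A → KBar K} {r : LinesThroughZero K A → KBar K}
  {s : LinesNotThroughZero K A → KBar K}

theorem ptFun_lineThrough_neg (r : LinesThroughZero K A → KBar K) (v : Plane3) :
    ptFun e (fun T => r (lineThrough K A T)) (-v) = ptFun e (fun T => r (lineThrough K A T)) v := by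
  by_cases hv : v = 0
  · rw [hv, neg_zero]
  · rw [ptFun_of_ne e _ hv, ptFun_of_ne e _ (neg_ne_zero.2 hv)]
    congr 1
    exact (lineThrough_ptOf_eq_iff e).2 (Or.inr rfl)

/-- Consequently `γ` times the correction has products `s` over the lines avoiding 0. -/
theorem finprod_correction [CharZero K] (hγ : ∀ T, γ T ≠ 0) (ha : ∀ T, a T = γ T ^ 3)
    (h : CoordCubeRoots (ptFun e a) (ptFun e fun T => r (lineThrough K A T)) (lnFun e s))
    (l : LinesNotThroughZero K A) :
    (∏ᶠ y : {y : IncidentPairs K A // incLine K A y = l}, correction γ r s (incPoint K A y.1)) =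
      s l / linesProd γ l := by
  obtain ⟨φ, hφ, rfl⟩ := lnOf_surjective e l
  have hdiv : ∀ φ (hφ : φ ≠ 0), (lnFun e s (-φ) / lnFun e (linesProd γ) (-φ)) /
      (lnFun e s φ / lnFun e (linesProd γ) φ) =
        (fun l => (s (negLine l) / linesProd γ (negLine l)) / (s l / linesProd γ l)) (lnOf K e φ hφ) :=
      fun φ hφ => by
    simp only [negLine_lnOf, lnFun_of_ne e _ hφ, lnFun_of_ne e _ (neg_ne_zero.2 hφ)]
  have key := h.prod_eq (three_ne_zero_KBar (K := K)) (coordCubeRoots_directionsProd_linesProd e ha)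
    (z := ptFun e (commonValue fun l => (s (negLine l) / linesProd γ (negLine l)) /
      (s l / linesProd γ l)))
    (fun v => ?_) (ptFun_lineThrough_neg r) (ptFun_lineThrough_neg _) (ptFun_zero _ _)
    (lnFun_zero _ _) (ptFun_zero _ _) (lnFun_zero _ _) (fun v hv x hx => ?_)
    (fun v hv hx => ?_) φ hφ
  · rw [finprod_incLine e hφ, ← lnFun_of_ne e s hφ, ← lnFun_of_ne e (linesProd γ) hφ, ← key]
    refine Finset.prod_congr rfl fun v _ => ?_
    split_ifs with hv
    · have hv0 := Plane3.right_ne_zero hv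
      rw [ptFun_of_ne e _ hv0, ptFun_of_ne e _ hv0, ptFun_of_ne e _ hv0, ptFun_of_ne e _ hv0]
      rfl
    · rfl
  · by_cases hv : v = 0
    · rw [hv, ptFun_zero]; exact one_ne_zero
    · rw [ptFun_of_ne e _ hv, ha]; exact pow_ne_zero 3 (hγ _)
  · rw [ptFun_of_ne e _ hv]
    refine commonValue_eq e fun l hl => ?_
    obtain ⟨ψ, hψ, rfl⟩ := lnOf_surjective e l
    rw [← hx ψ ((ptOf_mem_lnOf e (hv := hv) (hφ := hψ)).1 hl), hdiv ψ hψ]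
  · rw [ptFun_of_ne e _ hv]
    refine commonValue_of_not fun ⟨x, hl⟩ => hx ⟨x, fun ψ hψ => ?_⟩
    rw [hdiv ψ (Plane3.left_ne_zero hψ)]
    exact hl _ ((ptOf_mem_lnOf e (hv := hv) (hφ := Plane3.left_ne_zero hψ)).2 hψ)

theorem linesProd_ne_zero (e : A ≃+ Plane3) (hγ : ∀ T, γ T ≠ 0) (l : LinesNotThroughZero K A) :
    linesProd γ l ≠ 0 := by
  obtain ⟨S₁, S₂, S₃, hl⟩ := exists_triple e l
  rw [linesProd, finprod_incLine_eq e hl]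
  exact mul_ne_zero (mul_ne_zero (hγ _) (hγ _)) (hγ _)

/-- Both factors are built from quotients of two cube roots of the same norm. Hence the correction
does not disturb `γ³ = α`. -/
theorem correction_pow (hγ : ∀ T, γ T ≠ 0) (ha : ∀ T, a T = γ T ^ 3)
    (h : CoordCubeRoots (ptFun e a) (ptFun e fun T => r (lineThrough K A T)) (lnFun e s))
    (T : NonzeroPts K A) : correction γ r s T ^ 3 = 1 := by
  have h₀ := coordCubeRoots_directionsProd_linesProd e ha
  have hne : ∀ v, ptFun e a v ≠ 0 := fun v => by
    by_cases hv : v = 0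
    · rw [hv, ptFun_zero]; exact one_ne_zero
    · rw [ptFun_of_ne e _ hv, ha]; exact pow_ne_zero 3 (hγ _)
  have hs : ∀ l, (s l / linesProd γ l) ^ 3 = 1 := fun l => by
    obtain ⟨φ, hφ, rfl⟩ := lnOf_surjective e l
    rw [← lnFun_of_ne e s hφ, ← lnFun_of_ne e (linesProd γ) hφ, div_pow, ← h.line φ hφ,
      ← h₀.line φ hφ, div_self]
    exact Finset.prod_ne_zero_iff.2 fun v _ => by
      split_ifs
      exacts [hne v, one_ne_zero]
  rw [correction, mul_pow, commonValue_pow e fun l => by rw [div_pow, hs, hs, div_one], mul_one]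
  obtain ⟨v, hv, rfl⟩ := ptOf_surjective K e T
  have h1 := h.pair v hv
  have h2 := h₀.pair v hv
  rw [ptFun_of_ne e (fun T => r (lineThrough K A T)) hv] at h1
  rw [ptFun_of_ne e (fun T => directionsProd γ (lineThrough K A T)) hv] at h2
  rw [inv_pow, div_pow, ← h1, ← h2, div_self (mul_ne_zero (hne _) (hne _)), inv_one]

end Correction

/-! ### Units of étale algebras, extension by 1 at the origin, and the map ∂. -/

section Units

variable {K : Type u} [Field K] {X : Type*} [MulAction (GalK K) X]

theorem EtaleAlg.val_ne_zero (b : (EtaleAlg K X)ˣ) (x : X) : b.1.1 x ≠ 0 := fun h => by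
  have := congrFun (congrArg Subtype.val b.mul_inv) x
  change b.1.1 x * _ = 1 at this
  rw [h, zero_mul] at this
  exact zero_ne_one this

/-- An equivariant function without zeros is a unit of the étale algebra. -/
def EtaleAlg.mkUnit (g : X → (KBar K)ˣ)
    (hg : ∀ (σ : GalK K) x, (g (σ • x) : KBar K) = σ (g x : KBar K)) : (EtaleAlg K X)ˣ where
  val := ⟨fun x => g x, hg⟩
  inv := ⟨fun x => ((g x)⁻¹ : (KBar K)ˣ), fun σ x => by
    simp only [Units.val_inv_eq_inv_val, map_inv₀, hg]⟩
  val_inv := Subtype.ext (funext fun x => Units.mul_inv (g x))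
  inv_val := Subtype.ext (funext fun x => Units.inv_mul (g x))

end Units

section Extension

variable {K : Type u} [Field K] {A : Type*} [AddCommGroup A] [DistribMulAction (GalK K) A]

/-- The extension by `1` of a function on nonzero elements. -/
def extendByOne {M : Type*} [One M] (f : NonzeroPts K A → M) (T : A) : M :=
  open Classical in if h : T ≠ 0 then f ⟨T, h⟩ else 1

theorem extendByOne_zero {M : Type*} [One M] (f : NonzeroPts K A → M) : extendByOne f 0 = 1 :=
  dif_neg (not_not.2 rfl)

theorem extendByOne_val {M : Type*} [One M] (f : NonzeroPts K A → M) (T : NonzeroPts K A) :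
    extendByOne f T.1 = f T :=
  dif_pos T.2

theorem IsTwist.extendByOne_apply {w : GalK K → A → KBar K} {f : NonzeroPts K A → (KBar K)ˣ}
    (h : IsTwist w fun T => (f T : KBar K)) (σ : GalK K) (T : A) :
    σ ((extendByOne f T : (KBar K)ˣ) : KBar K) =
      w σ (σ • T) * ((extendByOne f (σ • T) : (KBar K)ˣ) : KBar K) := by
  by_cases hT : T = 0
  · rw [hT, smul_zero, extendByOne_zero, h.map_zero, one_mul, Units.val_one, map_one]
  · have h1 := extendByOne_val f ⟨T, hT⟩
    have h2 := extendByOne_val f (σ • ⟨T, hT⟩)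
    rw [h1]
    change _ = w σ (σ • T) *
      ((extendByOne f (σ • (⟨T, hT⟩ : NonzeroPts K A)).1 : (KBar K)ˣ) : KBar K)
    rw [h2]
    exact h.apply_eq σ ⟨T, hT⟩

/-- ∂ kills the homomorphism `w σ`, so ∂ of a twisted function is equivariant. -/
theorem IsTwist.partialMap_smul {w : GalK K → A → KBar K} {f : NonzeroPts K A → (KBar K)ˣ}
    (h : IsTwist w fun T => (f T : KBar K)) (σ : GalK K) (x : A × A) :
    ((partialMap (extendByOne f) (σ • x) : (KBar K)ˣ) : KBar K) =
      σ ((partialMap (extendByOne f) x : (KBar K)ˣ) : KBar K) := by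
  obtain ⟨S, T⟩ := x
  have hw : ∀ T, w σ T ≠ 0 := fun T h0 => by
    have := h.map_add σ T (-T)
    rw [add_neg_cancel, h.map_zero, h0, zero_mul] at this
    exact one_ne_zero this
  simp only [partialMap, Prod.smul_mk, Units.val_div_eq_div_val, Units.val_mul, map_div₀, map_mul,
    h.extendByOne_apply, smul_add, h.map_add]
  field_simp [hw]

/-- As `S₁ + S₂ = -S₃`, the factor f(-S₃) appears once in a denominator and once in a numerator. -/
theorem partialMap_mul_partialMap_neg {M : Type*} [CommGroup M] {f : A → M} (h : f 0 = 1)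
    {S₁ S₂ S₃ : A} (hS : S₁ + S₂ + S₃ = 0) :
    partialMap f (S₁, S₂) * partialMap f (S₃, -S₃) = f S₁ * f S₂ * f S₃ := by
  have : S₁ + S₂ = -S₃ := eq_neg_of_add_eq_zero_left hS
  simp only [partialMap, this, add_neg_cancel, h, div_one]
  rw [mul_comm (f S₃), ← mul_assoc, div_mul_cancel]

end Extension

end

/-! ### Proof of the proposition. -/

theorem mainTheorem6 {K : Type*} [Field K] [CharZero K] (E : WeierstrassCurve K) [E.IsElliptic]
    (ξ : H1 K (Tors E 3)) (α : (AlgL E 3)ˣ) (hα : RepresentsW1 ξ α) :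
    (∃ (r : AlgLPlus E 3) (s : AlgLPrime E 3), CubeRootConditions (α : AlgL E 3) r s) ∧
    ∀ (r : AlgLPlus E 3) (s : AlgLPrime E 3), CubeRootConditions (α : AlgL E 3) r s →
      ∃ ρ : (AlgRR E 3)ˣ, RepresentsW2 ξ ρ ∧ Compatible ξ α ρ ∧
        ∀ (l : LinesNotThroughZero K (Tors E 3)) (S₁ S₂ S₃ : Tors E 3),
          l.1 = {S₁, S₂, S₃} → s.1 l = ρ.1.1 (S₁, S₂) * ρ.1.1 (S₃, -S₃) := by
  obtain ⟨c, γ₀, b, hc, hγ₀, hαγ⟩ := hα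
  obtain ⟨e⟩ := exists_addEquiv_plane3 (A := Tors E 3) (fun a => Subtype.ext a.2) card_tors_three
  -- The equivariant factor `b` leaves the twist unchanged and makes γ³ equal to `α` on the nose.
  set γ : NonzeroPts K (Tors E 3) → KBar K := fun T => γ₀ T * b.1.1 T with hγ
  have hγ0 : ∀ T, γ T ≠ 0 := fun T => mul_ne_zero (γ₀ T).ne_zero (EtaleAlg.val_ne_zero b T)
  have ha : ∀ T, α.1.1 T = γ T ^ 3 := fun T => by rw [hαγ, hγ, mul_pow]
  have htw : IsTwist (fun σ T => weilPairing (c.1 σ) T) γ := by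
    refine ⟨fun σ => weilPairing_zero_right _, fun σ S T => weilPairing_add_right _ _ _,
      fun σ T => ?_⟩
    have h1 := hγ₀ σ (σ • T)
    rw [inv_smul_smul] at h1
    change _ = weilPairing (c.1 σ) (σ • T).1 * _
    rw [h1, hγ]
    simp only [map_mul]
    rw [b.1.2 σ T, ← mul_assoc, div_mul_cancel₀ _ (γ₀ (σ • T)).ne_zero]
  refine ⟨⟨⟨directionsProd γ, htw.directionsProd_smul e⟩, ⟨linesProd γ, htw.linesProd_smul e⟩,
    (cubeRootConditions_iff e _ _ _).2 (coordCubeRoots_directionsProd_linesProd e ha)⟩, ?_⟩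
  intro r s hrs
  rw [cubeRootConditions_iff e] at hrs
  have hζ := correction_pow hγ0 ha hrs
  -- The corrected cube root of `α`; its extension by 1 serves as γ for both `RepresentsW2` and
  -- `Compatible`, with the same cocycle `c`.
  set f : NonzeroPts K (Tors E 3) → (KBar K)ˣ := fun T =>
    Units.mk0 (γ T * correction γ r.1 s.1 T) (mul_ne_zero (hγ0 T) fun h => by
      have := hζ T
      rw [h, zero_pow three_ne_zero] at this
      exact zero_ne_one this) with hf
  have htw' : IsTwist (fun σ T => weilPairing (c.1 σ) T) fun T => (f T : KBar K) := by
    refine ⟨htw.map_zero, htw.map_add, fun σ T => ?_⟩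
    simp only [hf, Units.val_mk0, map_mul, htw.apply_eq, htw.correction_smul e, mul_assoc]
  have hweil : ∀ (σ : GalK K) (T : Tors E 3), weilPairing (c.1 σ) T =
      σ ((extendByOne f (σ⁻¹ • T) : (KBar K)ˣ) : KBar K) /
        ((extendByOne f T : (KBar K)ˣ) : KBar K) := fun σ T => by
    rw [htw'.extendByOne_apply, smul_inv_smul, mul_div_cancel_right₀ _ (Units.ne_zero _)]
  refine ⟨EtaleAlg.mkUnit (partialMap (extendByOne f)) htw'.partialMap_smul,
    ⟨c, extendByOne f, 1, hc, hweil, fun x => ?_⟩,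
    ⟨c, extendByOne f, hc, hweil, extendByOne_zero f, fun T => ?_, fun x => rfl⟩, ?_⟩
  · have : partialMap (1 : (AlgR E 3)ˣ).1.1 x = 1 := by
      change (1 : KBar K) * 1 / 1 = 1
      rw [mul_one, div_one]
    rw [this, mul_one]
    rfl
  · rw [extendByOne_val, ha]
    simp only [hf, Units.val_mk0, mul_pow, hζ, mul_one]
  · intro l S₁ S₂ S₃ hl
    have hne : ∀ S ∈ l.1, S ≠ 0 := fun S hS h0 => l.2.2 (h0 ▸ hS)
    lift S₁ to NonzeroPts K (Tors E 3) using hne S₁ (by rw [hl]; simp)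
    lift S₂ to NonzeroPts K (Tors E 3) using hne S₂ (by rw [hl]; simp)
    lift S₃ to NonzeroPts K (Tors E 3) using hne S₃ (by rw [hl]; simp)
    have hsum := (exists_model_triple e hl).1
    have hprod := finprod_correction hγ0 ha hrs l
    rw [finprod_incLine_eq e hl, eq_div_iff (linesProd_ne_zero e hγ0 l), linesProd,
      finprod_incLine_eq e hl] at hprod
    have h := congrArg (fun u : (KBar K)ˣ => (u : KBar K))
      (partialMap_mul_partialMap_neg (extendByOne_zero f) hsum)
    simp only [extendByOne_val, Units.val_mul] at h
    refine Eq.trans ?_ h.symm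
    rw [← hprod]
    simp only [hf, Units.val_mk0]
    ring
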